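/- Let $(M\,|\,\mathcal{R}M)$ be a smooth supermanifold of superdimension $(m|n)$: $M$ is a Hausdorff smooth manifold of dimension $m$ and $\mathcal{R}M\to M$ is a smooth real vector bundle whose fibres are unital superalgebras $\mathcal{R}_p=\mathcal{R}_{p,+}\oplus\mathcal{R}_{p,-}$, with smooth unit, multiplication and parity decomposition, such that every $\mathcal{R}_p$ is a free supercommutative superalgebra on $n$ odd generators (i.e. isomorphic as a superalgebra to $\Lambda\mathbb{R}^n$). For a superalgebra $\mathcal{A}$ let $\operatorname{sder}(\mathcal{A})=\operatorname{sder}_+(\mathcal{A})\oplus\operatorname{sder}_-(\mathcal{A})$ be the space of its ($\mathbb{R}$-linear) superderivations, where a homogeneous superderivation $D$ satisfies $D(ab)=D(a)b+(-1)^{|a||D|}aD(b)$ for homogeneous $a,b$. Let $\Gamma(\mathcal{R}M)$ be the superalgebra of smooth sections of $\mathcal{R}M$. Put $\operatorname{sder}_p(\mathcal{R}M)=\operatorname{sder}(\mathcal{R}_p)$, and let $\operatorname{Der}_p(\mathcal{R}M)$ be the space of the linear maps $D_p\colon\Gamma(\mathcal{R}M)\to\mathcal{R}_p$, $s\mapsto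 (Ds)(p)$, with $D\in\operatorname{sder}(\Gamma(\mathcal{R}M))$. Then every superderivation of $\Gamma(\mathcal{R}M)$ is a linear differential operator of order at most $1$. The families $\operatorname{sder}_p(\mathcal{R}M)$, $\operatorname{Der}_p(\mathcal{R}M)$ and $\mathcal{R}_p\otimes T_pM$, $p\in M$, are the fibres of smooth vector bundles $\operatorname{sder}(\mathcal{R}M)$, $\operatorname{Der}(\mathcal{R}M)$ and $\mathcal{R}M\otimes TM$ over $M$, where a section $A$ of $\operatorname{sder}(\mathcal{R}M)$ is smooth if and only if $p\mapsto A_p(s_p)$ is smooth for all $s\in\Gamma(\mathcal{R}M)$; the smooth sections of $\operatorname{Der}(\mathcal{R}M)$ are exactly the superderivations of $\Gamma(\mathcal{R}M)$, $D$ being identified with $p\mapsto D_p$; and $r\otimes X$ is smooth for all smooth sections $r$ of $\mathcal{R}M$ and $X$ of $TM$. There is an exact sequence of smooth vector bundles over $M$ $$0\to\operatorname{sder}(\mathcal{R}M)\xrightarrow{\ \iota\ }\operatorname{Der}(\mathcal{R}M)\xrightarrow{\ \sigma\ }\mathcal{R}M\otimes TM\to 0,$$ that is, $\iota$ and $\sigma$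 are smooth vector bundle maps over the identity of $M$ and the sequence is exact on every fibre. Here $\iota(A)(s)=A(s_p)$ for $A\in\operatorname{sder}_p(\mathcal{R}M)$ and $s\in\Gamma(\mathcal{R}M)$, and $\sigma$ is the principal symbol: for $D\in\operatorname{sder}(\Gamma(\mathcal{R}M))$, $f\in C^\infty(M)$, $\eta\in\Gamma(\mathcal{R}M)$ and $p\in M$, $$\big([D,f]\,\eta\big)(p)=\big(D(f\eta)-fD(\eta)\big)(p)=\langle\sigma(D_p),df_p\rangle\,\eta(p),$$ where $\langle r\otimes X,df_p\rangle=X(f)\,r$. -/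

import Mathlib

open Bundle Manifold
open scoped ContDiff TensorProduct

noncomputable section

/-! ### Superderivations of a superalgebra -/

section Superalgebra

variable {A : Type*} [Ring A] [Algebra ℝ A]

/-- For a superalgebra `A = A₀ ⊕ A₁`, the superderivations of parity `k` : linear endomorphisms `D`
of parity `k` with `D (a b) = D a b + (-1)^(|a| k) a D b` for homogeneous `a`, `b`. -/
def superderivationsOfParity (𝒜 : ZMod 2 → Submodule ℝ A) (k : ZMod 2) :
    Submodule ℝ (A →ₗ[ℝ] A) where
  carrier := {D | (∀ i, ∀ a ∈ 𝒜 i, D a ∈ 𝒜 (i + k)) ∧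
    ∀ i j, ∀ a ∈ 𝒜 i, ∀ b ∈ 𝒜 j, D (a * b) = D a * b + (-1 : ℝ) ^ (i * k).val • (a * D b)}
  zero_mem' := ⟨fun _ _ _ => by simp, fun _ _ _ _ _ _ => by simp⟩
  add_mem' := by
    rintro D D' ⟨h1, h2⟩ ⟨h1', h2'⟩
    refine ⟨fun i a ha => add_mem (h1 i a ha) (h1' i a ha), fun i j a ha b hb => ?_⟩
    simp only [LinearMap.add_apply, h2 i j a ha b hb, h2' i j a ha b hb, add_mul, mul_add, smul_add]
    abel
  smul_mem' := by
    rintro c D ⟨h1, h2⟩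
    refine ⟨fun i a ha => Submodule.smul_mem _ _ (h1 i a ha), fun i j a ha b hb => ?_⟩
    simp only [LinearMap.smul_apply, h2 i j a ha b hb, smul_add, smul_mul_assoc, mul_smul_comm]
    rw [smul_comm]

/-- The superspace `sder(A) = sder₊(A) ⊕ sder₋(A)` of all superderivations of a superalgebra. -/
def sder (𝒜 : ZMod 2 → Submodule ℝ A) : Submodule ℝ (A →ₗ[ℝ] A) :=
  superderivationsOfParity 𝒜 0 ⊔ superderivationsOfParity 𝒜 1

end Superalgebra

/-! ### Operators on sections of a vector bundle -/

section Operators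

variable {m : ℕ} {M : Type*} [TopologicalSpace M] [ChartedSpace (EuclideanSpace ℝ (Fin m)) M]
  {F : Type*} [NormedAddCommGroup F] [NormedSpace ℝ F] {V : M → Type*}
  [∀ x, AddCommGroup (V x)] [∀ x, Module ℝ (V x)]
  [TopologicalSpace (TotalSpace F V)] [∀ x, TopologicalSpace (V x)] [FiberBundle F V]
  [VectorBundle ℝ F V]

/-- Multiplication of smooth sections by a smooth function `f`. -/
def functionMul (f : C^∞⟮𝓡 m, M; ℝ⟯) : Cₛ^∞⟮𝓡 m; F, V⟯ →ₗ[ℝ] Cₛ^∞⟮𝓡 m; F, V⟯ where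
  toFun s := ⟨fun x => f x • s x, f.contMDiff.smul_section s.contMDiff⟩
  map_add' s t := by ext x; simp
  map_smul' c s := by ext x; exact smul_comm (f x) c (s x)

/-- The commutator `[D, f] ψ = D (f ψ) - f D ψ`. -/
def opCommutator (D : Cₛ^∞⟮𝓡 m; F, V⟯ →ₗ[ℝ] Cₛ^∞⟮𝓡 m; F, V⟯) (f : C^∞⟮𝓡 m, M; ℝ⟯) :
    Cₛ^∞⟮𝓡 m; F, V⟯ →ₗ[ℝ] Cₛ^∞⟮𝓡 m; F, V⟯ :=
  D ∘ₗ functionMul f - functionMul f ∘ₗ D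

/-- Linear differential operators of order at most `k` : the commutators with any `k + 1` smooth
functions vanish. -/
def IsDiffOp : ℕ → (Cₛ^∞⟮𝓡 m; F, V⟯ →ₗ[ℝ] Cₛ^∞⟮𝓡 m; F, V⟯) → Prop
  | 0, D => ∀ f : C^∞⟮𝓡 m, M; ℝ⟯, opCommutator D f = 0
  | k + 1, D => ∀ f : C^∞⟮𝓡 m, M; ℝ⟯, IsDiffOp k (opCommutator D f)

/-- The principal symbol of an operator `D` of order at most one, evaluated on a smooth function:
`σ_D(f) = [D, f]`. -/
def principalSymbolOne (D : Cₛ^∞⟮𝓡 m; F, V⟯ →ₗ[ℝ] Cₛ^∞⟮𝓡 m; F, V⟯) (f : C^∞⟮𝓡 m, M; ℝ⟯) :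
    Cₛ^∞⟮𝓡 m; F, V⟯ →ₗ[ℝ] Cₛ^∞⟮𝓡 m; F, V⟯ :=
  opCommutator D f

end Operators

/-! ### Supermanifolds as superalgebra bundles -/

section Supermanifold

/-- A vector bundle whose fibres are algebras is a smooth algebra bundle if the unit section and
products of smooth (germs of) sections are smooth. -/
class IsSmoothAlgebraBundle (m : ℕ) {M : Type*} [TopologicalSpace M]
    [ChartedSpace (EuclideanSpace ℝ (Fin m)) M]
    (F : Type*) [NormedAddCommGroup F] [NormedSpace ℝ F] (R : M → Type*)
    [∀ p, Ring (R p)] [∀ p, Algebra ℝ (R p)]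
    [TopologicalSpace (TotalSpace F R)] [∀ p, TopologicalSpace (R p)] [FiberBundle F R]
    [VectorBundle ℝ F R] : Prop where
  contMDiff_one : ContMDiff (𝓡 m) ((𝓡 m).prod 𝓘(ℝ, F)) ∞
    (fun p => TotalSpace.mk' F p (1 : R p))
  contMDiffAt_mul : ∀ (a b : ∀ p, R p) (p₀ : M),
    ContMDiffAt (𝓡 m) ((𝓡 m).prod 𝓘(ℝ, F)) ∞ (fun p => TotalSpace.mk' F p (a p)) p₀ →
    ContMDiffAt (𝓡 m) ((𝓡 m).prod 𝓘(ℝ, F)) ∞ (fun p => TotalSpace.mk' F p (b p)) p₀ →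
    ContMDiffAt (𝓡 m) ((𝓡 m).prod 𝓘(ℝ, F)) ∞ (fun p => TotalSpace.mk' F p (a p * b p)) p₀

/-- `(M | R)` is a smooth supermanifold of superdimension `(m | n)` : `R` is a smooth bundle of
superalgebras over the `m`-manifold `M` (the algebra structure being smooth as above, the
even and odd components of a smooth section being smooth), and every fibre is a free
supercommutative superalgebra on `n` odd generators, that is, isomorphic as a superalgebra to the
exterior algebra of `ℝⁿ` with its parity grading. -/
structure IsSupermanifold (m n : ℕ) {M : Type*} [TopologicalSpace M]
    [ChartedSpace (EuclideanSpace ℝ (Fin m)) M]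
    (F : Type*) [NormedAddCommGroup F] [NormedSpace ℝ F] (R : M → Type*)
    [∀ p, Ring (R p)] [∀ p, Algebra ℝ (R p)]
    [TopologicalSpace (TotalSpace F R)] [∀ p, TopologicalSpace (R p)] [FiberBundle F R]
    [VectorBundle ℝ F R] (𝒜 : ∀ p, ZMod 2 → Submodule ℝ (R p)) [∀ p, GradedAlgebra (𝒜 p)]
    [IsSmoothAlgebraBundle m F R] : Prop where
  contMDiffAt_component : ∀ (i : ZMod 2) (a : ∀ p, R p) (p₀ : M),
    ContMDiffAt (𝓡 m) ((𝓡 m).prod 𝓘(ℝ, F)) ∞ (fun p => TotalSpace.mk' F p (a p)) p₀ →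
    ContMDiffAt (𝓡 m) ((𝓡 m).prod 𝓘(ℝ, F)) ∞
      (fun p => TotalSpace.mk' F p (GradedRing.proj (𝒜 p) i (a p))) p₀
  free : ∀ p, ∃ φ : ExteriorAlgebra ℝ (Fin n → ℝ) ≃ₐ[ℝ] R p, ∀ i,
    (CliffordAlgebra.evenOdd (0 : QuadraticForm ℝ (Fin n → ℝ)) i).map φ.toLinearMap = 𝒜 p i

variable {m : ℕ} {M : Type*} [TopologicalSpace M] [ChartedSpace (EuclideanSpace ℝ (Fin m)) M]
  {F : Type*} [NormedAddCommGroup F] [NormedSpace ℝ F] {R : M → Type*}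
  [∀ p, Ring (R p)] [∀ p, Algebra ℝ (R p)]
  [TopologicalSpace (TotalSpace F R)] [∀ p, TopologicalSpace (R p)] [FiberBundle F R]
  [VectorBundle ℝ F R]

/-- The ring `Γ(R)` of superfunctions, with pointwise operations. -/
instance sectionRing [h : IsSmoothAlgebraBundle m F R] : Ring Cₛ^∞⟮𝓡 m; F, R⟯ :=
  { (inferInstance : AddCommGroup Cₛ^∞⟮𝓡 m; F, R⟯) with
    mul := fun a b => ⟨fun p => a p * b p,
      fun p => h.contMDiffAt_mul _ _ p (a.contMDiff p) (b.contMDiff p)⟩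
    one := ⟨fun _ => 1, h.contMDiff_one⟩
    mul_assoc := fun a b c => ContMDiffSection.ext fun p => mul_assoc (a p) (b p) (c p)
    one_mul := fun a => ContMDiffSection.ext fun p => one_mul (a p)
    mul_one := fun a => ContMDiffSection.ext fun p => mul_one (a p)
    left_distrib := fun a b c => ContMDiffSection.ext fun p => mul_add (a p) (b p) (c p)
    right_distrib := fun a b c => ContMDiffSection.ext fun p => add_mul (a p) (b p) (c p)
    zero_mul := fun a => ContMDiffSection.ext fun p => zero_mul (a p)
    mul_zero := fun a => ContMDiffSection.ext fun p => mul_zero (a p) }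

instance sectionAlgebra [IsSmoothAlgebraBundle m F R] : Algebra ℝ Cₛ^∞⟮𝓡 m; F, R⟯ :=
  Algebra.ofModule
    (fun c a b => ContMDiffSection.ext fun p => smul_mul_assoc c (a p) (b p))
    (fun c a b => ContMDiffSection.ext fun p => mul_smul_comm c (a p) (b p))

theorem section_mul_apply [IsSmoothAlgebraBundle m F R] (a b : Cₛ^∞⟮𝓡 m; F, R⟯) (p : M) :
    (a * b) p = a p * b p := rfl

theorem section_one_apply [IsSmoothAlgebraBundle m F R] (p : M) :
    (1 : Cₛ^∞⟮𝓡 m; F, R⟯) p = 1 := rfl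

variable (m F) in
/-- The parity grading of the superfunctions: even (odd) sections are the fibrewise even (odd)
ones. -/
def sectionParity (𝒜 : ∀ p, ZMod 2 → Submodule ℝ (R p)) [IsSmoothAlgebraBundle m F R]
    (i : ZMod 2) : Submodule ℝ Cₛ^∞⟮𝓡 m; F, R⟯ where
  carrier := {a | ∀ p, a p ∈ 𝒜 p i}
  zero_mem' := fun p => (𝒜 p i).zero_mem
  add_mem' := fun ha hb p => (𝒜 p i).add_mem (ha p) (hb p)
  smul_mem' := fun c _ ha p => (𝒜 p i).smul_mem c (ha p)

variable (m F) in
/-- The superspace `sder(Γ(R))` of superderivations of the algebra of superfunctions. -/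
abbrev SuperVectorField (𝒜 : ∀ p, ZMod 2 → Submodule ℝ (R p)) [IsSmoothAlgebraBundle m F R] :
    Submodule ℝ (Cₛ^∞⟮𝓡 m; F, R⟯ →ₗ[ℝ] Cₛ^∞⟮𝓡 m; F, R⟯) :=
  sder (sectionParity m F 𝒜)

variable (m F) in
/-- The value at `p` of a superderivation `D` of `Γ(R)`, as the linear map `s ↦ (D s)(p)`. -/
def evalAt (𝒜 : ∀ p, ZMod 2 → Submodule ℝ (R p)) [IsSmoothAlgebraBundle m F R] (p : M) :
    SuperVectorField m F 𝒜 →ₗ[ℝ] (Cₛ^∞⟮𝓡 m; F, R⟯ →ₗ[ℝ] R p) where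
  toFun D :=
    { toFun := fun s => D.1 s p
      map_add' := fun s t => by simp
      map_smul' := fun c s => by simp }
  map_add' D D' := rfl
  map_smul' c D := rfl

variable (m F) in
/-- The fibre at `p` of the bundle `Der(R)` of superderivations of `Γ(R)` : the values at `p` of
the superderivations of `Γ(R)`. -/
abbrev derFibre (𝒜 : ∀ p, ZMod 2 → Submodule ℝ (R p)) [IsSmoothAlgebraBundle m F R] (p : M) :
    Submodule ℝ (Cₛ^∞⟮𝓡 m; F, R⟯ →ₗ[ℝ] R p) :=
  LinearMap.range (evalAt m F 𝒜 p)

variable (m F) in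
/-- The value at `p` of a superderivation of `Γ(R)`, as an element of the fibre of `Der(R)`. -/
abbrev derValue (𝒜 : ∀ p, ZMod 2 → Submodule ℝ (R p)) [IsSmoothAlgebraBundle m F R] (p : M) :
    SuperVectorField m F 𝒜 →ₗ[ℝ] derFibre m F 𝒜 p :=
  (evalAt m F 𝒜 p).rangeRestrict

/-- The fibre at `p` of the bundle `sder(R)` of pointwise superderivations. -/
abbrev sderFibre (𝒜 : ∀ p, ZMod 2 → Submodule ℝ (R p)) (p : M) :
    Submodule ℝ (R p →ₗ[ℝ] R p) :=
  sder (𝒜 p)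

/-- The contraction `R_p ⊗ T_pM → R_p`, `r ⊗ X ↦ X(f) r`, with the differential of `f`. -/
def contractDiff (m : ℕ) {M : Type*} [TopologicalSpace M]
    [ChartedSpace (EuclideanSpace ℝ (Fin m)) M] {R : M → Type*} [∀ p, Ring (R p)]
    [∀ p, Algebra ℝ (R p)] (f : C^∞⟮𝓡 m, M; ℝ⟯) (p : M) :
    R p ⊗[ℝ] TangentSpace (𝓡 m) p →ₗ[ℝ] R p :=
  (TensorProduct.rid ℝ (R p)).toLinearMap ∘ₗ
    LinearMap.lTensor (R p) (mvfderiv (𝓡 m) f p).toLinearMap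

end Supermanifold

/-! ### Smooth vector bundle structures on families of vector spaces -/

/-- The structure of a smooth real vector bundle of finite rank over the `m`-manifold `M` on the
family of vector spaces `V p`, `p ∈ M`. -/
structure SmoothBundleStructure (m : ℕ) {M : Type*} [TopologicalSpace M]
    [ChartedSpace (EuclideanSpace ℝ (Fin m)) M] (V : M → Type*)
    [∀ p, AddCommGroup (V p)] [∀ p, Module ℝ (V p)] where
  rank : ℕ
  topFibre : ∀ p, TopologicalSpace (V p)
  topTotal : TopologicalSpace (TotalSpace (EuclideanSpace ℝ (Fin rank)) V)
  fiberBundle : FiberBundle (EuclideanSpace ℝ (Fin rank)) V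
  vectorBundle : VectorBundle ℝ (EuclideanSpace ℝ (Fin rank)) V
  smooth : ContMDiffVectorBundle ∞ (EuclideanSpace ℝ (Fin rank)) V (𝓡 m)

namespace SmoothBundleStructure

variable {m : ℕ} {M : Type*} [TopologicalSpace M] [ChartedSpace (EuclideanSpace ℝ (Fin m)) M]
  {V W : M → Type*} [∀ p, AddCommGroup (V p)] [∀ p, Module ℝ (V p)]
  [∀ p, AddCommGroup (W p)] [∀ p, Module ℝ (W p)]

/-- Smoothness of a global section. -/
def IsSmoothSection (B : SmoothBundleStructure m V) (s : ∀ p, V p) : Prop :=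
  letI := B.topFibre
  letI := B.topTotal
  letI := B.fiberBundle
  ContMDiff (𝓡 m) ((𝓡 m).prod 𝓘(ℝ, EuclideanSpace ℝ (Fin B.rank))) ∞
    (fun p => TotalSpace.mk' (EuclideanSpace ℝ (Fin B.rank)) p (s p))

/-- A family of linear maps of the fibres is a smooth vector bundle map (over the identity) if
the map it defines between the total spaces is smooth. -/
def IsSmoothMap (B : SmoothBundleStructure m V) (C : SmoothBundleStructure m W)
    (φ : ∀ p, V p →ₗ[ℝ] W p) : Prop :=
  letI := B.topFibre
  letI := B.topTotal
  letI := B.fiberBundle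
  letI := C.topFibre
  letI := C.topTotal
  letI := C.fiberBundle
  ContMDiff ((𝓡 m).prod 𝓘(ℝ, EuclideanSpace ℝ (Fin B.rank)))
    ((𝓡 m).prod 𝓘(ℝ, EuclideanSpace ℝ (Fin C.rank))) ∞
    (fun v : TotalSpace (EuclideanSpace ℝ (Fin B.rank)) V =>
      TotalSpace.mk' (EuclideanSpace ℝ (Fin C.rank)) v.proj (φ v.proj v.snd))

end SmoothBundleStructure

section TheBundles

variable {m : ℕ} {M : Type*} [TopologicalSpace M] [ChartedSpace (EuclideanSpace ℝ (Fin m)) M]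
  (F : Type*) [NormedAddCommGroup F] [NormedSpace ℝ F] {R : M → Type*}
  [∀ p, Ring (R p)] [∀ p, Algebra ℝ (R p)]
  [TopologicalSpace (TotalSpace F R)] [∀ p, TopologicalSpace (R p)] [FiberBundle F R]
  [VectorBundle ℝ F R]

/-- `B` is the bundle `sder(R)`, as a subbundle of `End(R)` : a section `A` is smooth exactly when
`p ↦ A_p (s_p)` is smooth for every smooth section `s` of `R`. -/
def IsPointwiseDerivationBundle (𝒜 : ∀ p, ZMod 2 → Submodule ℝ (R p))
    (B : SmoothBundleStructure m (fun p => sderFibre 𝒜 p)) : Prop :=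
  ∀ A : ∀ p, sderFibre 𝒜 p, B.IsSmoothSection A ↔
    ∀ s : Cₛ^∞⟮𝓡 m; F, R⟯, ContMDiff (𝓡 m) ((𝓡 m).prod 𝓘(ℝ, F)) ∞
      (fun p => TotalSpace.mk' F p ((A p).1 (s p)))

/-- `B` is the bundle `Der(R)` : its smooth sections are exactly the superderivations of `Γ(R)`. -/
def IsDerivationBundle (𝒜 : ∀ p, ZMod 2 → Submodule ℝ (R p)) [IsSmoothAlgebraBundle m F R]
    (B : SmoothBundleStructure m (fun p => derFibre m F 𝒜 p)) : Prop :=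
  ∀ δ : ∀ p, derFibre m F 𝒜 p, B.IsSmoothSection δ ↔
    ∃ D : SuperVectorField m F 𝒜, ∀ p, δ p = derValue m F 𝒜 p D

/-- `B` is the tensor product bundle `R ⊗ TM` : for smooth sections `r` of `R` and smooth vector
fields `X` the section `r ⊗ X` is smooth. (Local frames of `R` and `TM` then give smooth local
frames `rᵢ ⊗ Xⱼ`, so this determines the smooth bundle structure.) -/
def IsTensorTangentBundle [IsManifold (𝓡 m) ∞ M]
    (B : SmoothBundleStructure m (fun p => R p ⊗[ℝ] TangentSpace (𝓡 m) p)) : Prop :=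
  ∀ (r : Cₛ^∞⟮𝓡 m; F, R⟯)
    (X : Cₛ^∞⟮𝓡 m; EuclideanSpace ℝ (Fin m), fun p : M => TangentSpace (𝓡 m) p⟯),
    B.IsSmoothSection (fun p => r p ⊗ₜ[ℝ] X p)

end TheBundles

end

/-! Functions are even, so every superderivation `D` obeys the unsigned rule `D(fη) = D(f)η + f
D(η)`. Hence `[D, f]` is multiplication by the superfunction `D(f)`; this commutes with
multiplication by functions, which gives order at most one. The same rule with a cut-off function
shows that `D` is local, so the fibres can be studied in charts.

A chart needs a local trivialization of `R` as a bundle of superalgebras (`exists_superFrame`).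
Generators of one fibre are extended constantly in a vector bundle trivialization and projected to
their odd parts. Odd elements square to zero, so the universal property of the exterior algebra
yields algebra homomorphisms, which stay bijective near the given point. Base coordinates `x_j` with
fields `X_j` complete the chart.

In a chart, the values at `q` of superderivations are exactly the operators `s ↦ A(s(q)) + ∑ r_j
(X_j s)(q)`, with `A` a superderivation of the Grassmann algebra and arbitrary Grassmann elements
`r_j`. Every value has this form (`exists_op_eq`): `A` is read off on constants and `r_j` on `x_j`.
This suffices because each scalar component of `f ↦ D(f)(q)` is a point derivation, which by
Hadamard's lemma depends only on `df_q`. Conversely, each such operator is a value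
(`op_mem_derFibre`), because an operator with constant symbol remains a superderivation after
multiplication by a cut-off function. In these coordinates `ι` is `A ↦ (A, 0)` and `σ` is `(A, r) ↦
∑ r_j ⊗ X_j`, so exactness is visible (`exact_inclusion_symbol`).

For the smooth structures, smoothness of a section of each family is defined by testing: on
superfunctions for the two derivation bundles, by contraction with differentials for the tensor
bundle. Charts turn each test into smoothness of coordinates, and `exists_smoothBundleStructure`
then produces the bundle. The maps `ι` and `σ` preserve these tests, hence are smooth. Finally, a
smooth family of values may come from a different superderivation at each point;
`exists_superVectorField` assembles it into one, since its parity components are determined by the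
family. -/

open Filter Topology

noncomputable section

/-! ### Weakly smooth maps into vector spaces without a norm -/

section WeaklySmooth

variable {m : ℕ} {M : Type*} [TopologicalSpace M] [ChartedSpace (EuclideanSpace ℝ (Fin m)) M]
  {E E' E'' : Type*} [AddCommGroup E] [Module ℝ E] [AddCommGroup E'] [Module ℝ E']
  [AddCommGroup E''] [Module ℝ E'']

variable (m) in
/-- A map into a real vector space is weakly smooth at a point if its composites with all linear
functionals are smooth there. -/
def WeaklySmoothAt (g : M → E) (q : M) : Prop :=
  ∀ l : E →ₗ[ℝ] ℝ, ContMDiffAt (𝓡 m) 𝓘(ℝ, ℝ) ∞ (fun p => l (g p)) q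

namespace WeaklySmoothAt

variable {g h : M → E} {q : M}

theorem congr (hg : WeaklySmoothAt m g q) (he : ∀ᶠ p in 𝓝 q, g p = h p) :
    WeaklySmoothAt m h q := fun l =>
  (hg l).congr_of_eventuallyEq (he.mono fun p hp => by simp [hp])

theorem linearMap (hg : WeaklySmoothAt m g q) (T : E →ₗ[ℝ] E') :
    WeaklySmoothAt m (fun p => T (g p)) q := fun l => hg (l ∘ₗ T)

/-- Over a field an injective linear map has a linear left inverse, so every functional on the
source factors through the target. -/
theorem of_injective {T : E →ₗ[ℝ] E'} (hT : Function.Injective T)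
    (hg : WeaklySmoothAt m (fun p => T (g p)) q) : WeaklySmoothAt m g q := by
  obtain ⟨S, hS⟩ := T.exists_leftInverse_of_injective (LinearMap.ker_eq_bot.2 hT)
  refine (hg.linearMap S).congr (Eventually.of_forall fun p => ?_)
  exact LinearMap.congr_fun hS (g p)

theorem const (v : E) : WeaklySmoothAt m (fun _ : M => v) q := fun _ => contMDiffAt_const

theorem add (hg : WeaklySmoothAt m g q) (hh : WeaklySmoothAt m h q) :
    WeaklySmoothAt m (fun p => g p + h p) q := fun l => by
  simp only [map_add]
  exact (hg l).add (hh l)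

theorem sum {ι : Type*} {s : Finset ι} {g : ι → M → E} (hg : ∀ i ∈ s, WeaklySmoothAt m (g i) q) :
    WeaklySmoothAt m (fun p => ∑ i ∈ s, g i p) q := fun l => by
  simpa using contMDiffAt_finsetSum fun i hi => hg i hi l

theorem smul {c : M → ℝ} (hc : ContMDiffAt (𝓡 m) 𝓘(ℝ, ℝ) ∞ c q) (hg : WeaklySmoothAt m g q) :
    WeaklySmoothAt m (fun p => c p • g p) q := fun l => by
  simp only [map_smul, smul_eq_mul]
  exact hc.mul (hg l)

/-- Expanding the first argument in a basis reduces the claim to products of a smooth scalar and a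
linear image of the second argument, so only the first space must be finite-dimensional. -/
theorem bilinear [FiniteDimensional ℝ E] (B : E →ₗ[ℝ] E' →ₗ[ℝ] E'') {k : M → E'}
    (hg : WeaklySmoothAt m g q) (hk : WeaklySmoothAt m k q) :
    WeaklySmoothAt m (fun p => B (g p) (k p)) q := by
  let b := Module.finBasis ℝ E
  have : WeaklySmoothAt m (fun p => ∑ i, b.coord i (g p) • B (b i) (k p)) q :=
    sum fun i _ => smul (hg _) (hk.linearMap _)
  refine this.congr (Eventually.of_forall fun p => ?_)
  conv_rhs => rw [← b.sum_repr (g p), map_sum, LinearMap.sum_apply]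
  simp

theorem pi {ι : Type*} [Finite ι] {g : M → ι → E} (hg : ∀ i, WeaklySmoothAt m (fun p => g p i) q) :
    WeaklySmoothAt m g q := by
  classical
  have := Fintype.ofFinite ι
  have : WeaklySmoothAt m (fun p => ∑ i, LinearMap.single ℝ (fun _ => E) i (g p i)) q :=
    sum fun i _ => (hg i).linearMap _
  refine this.congr (Eventually.of_forall fun p => ?_)
  simp [Finset.univ_sum_single]

theorem prodMk {k : M → E'} (hg : WeaklySmoothAt m g q) (hk : WeaklySmoothAt m k q) :
    WeaklySmoothAt m (fun p => (g p, k p)) q := by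
  refine ((hg.linearMap (LinearMap.inl ℝ E E')).add (hk.linearMap (LinearMap.inr ℝ E E'))).congr
    (Eventually.of_forall fun p => ?_)
  simp

/-- Evaluation on a finite basis embeds the space of linear maps into a power of the target. -/
theorem hom [FiniteDimensional ℝ E] {A : M → E →ₗ[ℝ] E'}
    (hA : ∀ v, WeaklySmoothAt m (fun p => A p v) q) : WeaklySmoothAt m A q := by
  let b := Module.finBasis ℝ E
  refine of_injective (T := LinearMap.pi fun i => LinearMap.applyₗ (b i)) (fun A A' h => ?_)
    (pi fun i => hA (b i))
  exact b.ext fun i => congrFun h i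

end WeaklySmoothAt

theorem contMDiffAt_iff_weaklySmoothAt {E : Type*} [NormedAddCommGroup E] [NormedSpace ℝ E]
    [FiniteDimensional ℝ E] {g : M → E} {q : M} :
    ContMDiffAt (𝓡 m) 𝓘(ℝ, E) ∞ g q ↔ WeaklySmoothAt m g q := by
  refine ⟨fun hg l => l.toContinuousLinearMap.contMDiff.contMDiffAt.comp q hg, fun hg => ?_⟩
  let b := Module.finBasis ℝ E
  have : ContMDiffAt (𝓡 m) 𝓘(ℝ, E) ∞ (fun p => ∑ i, b.coord i (g p) • b i) q :=
    contMDiffAt_finsetSum fun i _ => (hg (b.coord i)).smul contMDiffAt_const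
  simpa only [Module.Basis.coord_apply, b.sum_repr] using this

end WeaklySmooth

/-! ### Bundle structures from local frames -/

section LocalFrames

variable {m : ℕ} {M : Type*} [TopologicalSpace M] [ChartedSpace (EuclideanSpace ℝ (Fin m)) M]
  {V W : M → Type*} [∀ p, AddCommGroup (V p)] [∀ p, Module ℝ (V p)]
  [∀ p, AddCommGroup (W p)] [∀ p, Module ℝ (W p)]

namespace SmoothBundleStructure

/-- Smoothness of a section at a point. -/
def IsSmoothSectionAt (B : SmoothBundleStructure m V) (s : ∀ p, V p) (q : M) : Prop :=
  letI := B.topFibre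
  letI := B.topTotal
  letI := B.fiberBundle
  ContMDiffAt (𝓡 m) ((𝓡 m).prod 𝓘(ℝ, EuclideanSpace ℝ (Fin B.rank))) ∞
    (fun p => TotalSpace.mk' (EuclideanSpace ℝ (Fin B.rank)) p (s p)) q

theorem isSmoothSection_iff (B : SmoothBundleStructure m V) (s : ∀ p, V p) :
    B.IsSmoothSection s ↔ ∀ q, B.IsSmoothSectionAt s q := Iff.rfl

/-- A family of linear maps preserving the smoothness of local sections is a smooth bundle map. -/
theorem isSmoothMap_of_isSmoothSectionAt [IsManifold (𝓡 m) ∞ M] (B : SmoothBundleStructure m V)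
    (C : SmoothBundleStructure m W) (φ : ∀ p, V p →ₗ[ℝ] W p)
    (h : ∀ s q, B.IsSmoothSectionAt s q → C.IsSmoothSectionAt (fun p => φ p (s p)) q) :
    B.IsSmoothMap C φ := by
  let := B.topFibre
  let := B.topTotal
  let := B.fiberBundle
  let := C.topFibre
  let := C.topTotal
  let := C.fiberBundle
  have := B.vectorBundle
  have := C.vectorBundle
  have := B.smooth
  have := C.smooth
  let EB := EuclideanSpace ℝ (Fin B.rank)
  let EC := EuclideanSpace ℝ (Fin C.rank)
  intro v₀
  let p₀ := v₀.proj
  let e := trivializationAt EB V p₀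
  let e' := trivializationAt EC W p₀
  have hp : p₀ ∈ e.baseSet := FiberBundle.mem_baseSet_trivializationAt' p₀
  have hp' : p₀ ∈ e'.baseSet := FiberBundle.mem_baseSet_trivializationAt' p₀
  let b : Module.Basis (Fin B.rank) ℝ EB := (EuclideanSpace.basisFun (Fin B.rank) ℝ).toBasis
  have hproj : ContMDiffAt ((𝓡 m).prod 𝓘(ℝ, EB)) (𝓡 m) ∞ (TotalSpace.proj : TotalSpace EB V → M) v₀ :=
    contMDiffAt_proj V
  rw [contMDiffAt_totalSpace]
  refine ⟨hproj, ?_⟩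
  -- Constant vectors in a trivialization are smooth local sections, so the hypothesis applies to
  -- them, and by fibrewise linearity their images determine `φ`.
  have hsec : ∀ i, ContMDiffAt (𝓡 m) 𝓘(ℝ, EC) ∞
      (fun p => (e' ⟨p, φ p (e.symm p (b i))⟩).2) p₀ := by
    intro i
    refine (e'.contMDiffAt_section_iff hp').1 (h (fun p => e.symm p (b i)) p₀ ?_)
    refine (e.contMDiffAt_section_iff hp).2 ?_
    refine (contMDiffAt_const (c := b i)).congr_of_eventuallyEq ?_
    filter_upwards [e.open_baseSet.mem_nhds hp] with p hpe
    exact congrArg Prod.snd (e.apply_mk_symm hpe (b i))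
  have hcoord : ContMDiffAt ((𝓡 m).prod 𝓘(ℝ, EB)) 𝓘(ℝ, EB) ∞
      (fun v : TotalSpace EB V => (e v).2) v₀ := by
    have := (e.contMDiffOn (IB := 𝓡 m) (n := ∞)).contMDiffAt
      (e.open_source.mem_nhds (e.mem_source.2 hp))
    exact contMDiffAt_snd.comp v₀ this
  have key : ContMDiffAt ((𝓡 m).prod 𝓘(ℝ, EB)) 𝓘(ℝ, EC) ∞
      (fun v : TotalSpace EB V =>
        ∑ i, b.coord i (e v).2 • (e' ⟨v.proj, φ v.proj (e.symm v.proj (b i))⟩).2) v₀ := by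
    refine contMDiffAt_finsetSum fun i _ => ?_
    have h1 : ContMDiffAt ((𝓡 m).prod 𝓘(ℝ, EB)) 𝓘(ℝ, ℝ) ∞
        (fun v : TotalSpace EB V => b.coord i (e v).2) v₀ :=
      (b.coord i).toContinuousLinearMap.contMDiff.contMDiffAt.comp v₀ hcoord
    exact h1.smul (ContMDiffAt.comp (g := fun p => (e' ⟨p, φ p (e.symm p (b i))⟩).2) v₀ (hsec i) hproj)
  refine key.congr_of_eventuallyEq ?_
  have hcont : ContinuousAt (TotalSpace.proj : TotalSpace EB V → M) v₀ :=
    (FiberBundle.continuous_proj EB V).continuousAt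
  filter_upwards [hcont.preimage_mem_nhds (e.open_baseSet.mem_nhds hp),
    hcont.preimage_mem_nhds (e'.open_baseSet.mem_nhds hp')] with v hv hv'
  replace hv : v.proj ∈ e.baseSet := hv
  have hv2 : v.2 = ∑ i, b.coord i (e v).2 • e.symm v.proj (b i) := by
    calc v.2 = e.symmₗ ℝ v.proj (e v).2 := by
          rw [e.coe_symmₗ hv]; exact (e.symm_proj_apply v hv).symm
      _ = e.symmₗ ℝ v.proj (∑ i, b.repr (e v).2 i • b i) := by rw [b.sum_repr]
      _ = _ := by simp only [map_sum, map_smul, e.coe_symmₗ hv, Module.Basis.coord_apply]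
  have h2 : ∀ w : W v.proj, (e' ⟨v.proj, w⟩).2 = e'.linearMapAt ℝ v.proj w := fun w => by
    rw [e'.linearMapAt_apply]; exact (if_pos hv').symm
  have h3 : (e' ⟨v.proj, φ v.proj v.2⟩).2
      = ∑ i, b.coord i (e v).2 • (e' ⟨v.proj, φ v.proj (e.symm v.proj (b i))⟩).2 := by
    simp only [h2]
    rw [hv2]
    simp only [map_sum, map_smul]
  exact h3

end SmoothBundleStructure

end LocalFrames

/-! ### Hadamard's lemma -/

section Hadamard

open MeasureTheory

-- The derivative is again a parameter integral, now of a function with values in `E →L[ℝ] G`. The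
-- induction on `k` therefore ranges over all targets `G`, and one universe serves for `E` and `G`.
universe u in
theorem contDiff_intervalIntegral_param_nat {E : Type u} [NormedAddCommGroup E] [NormedSpace ℝ E]
    [FiniteDimensional ℝ E] (k : ℕ) : ∀ {G : Type u} [NormedAddCommGroup G] [NormedSpace ℝ G]
    [CompleteSpace G] {f : E × ℝ → G}, ContDiff ℝ ∞ f →
    ContDiff ℝ k (fun x => ∫ t in (0 : ℝ)..1, f (x, t)) := by
  have hderiv : ∀ {G : Type u} [NormedAddCommGroup G] [NormedSpace ℝ G]
      [CompleteSpace G] {f : E × ℝ → G}, ContDiff ℝ ∞ f → ∀ x₀,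
      HasFDerivAt (fun x => ∫ t in (0 : ℝ)..1, f (x, t))
        (∫ t in (0 : ℝ)..1, fderiv ℝ f (x₀, t) ∘L ContinuousLinearMap.inl ℝ E ℝ) x₀ := by
    intro G _ _ _ f hf x₀
    have hF' : Continuous fun z : E × ℝ => fderiv ℝ f z ∘L ContinuousLinearMap.inl ℝ E ℝ :=
      (hf.continuous_fderiv (by simp)).clm_comp continuous_const
    -- Compactness of the ball times the unit interval gives a constant that dominates the
    -- derivative.
    obtain ⟨C, hC⟩ := ((isCompact_closedBall x₀ 1).prod (isCompact_Icc (a := (0 : ℝ)) (b := 1))).exists_bound_of_continuousOn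
      hF'.continuousOn
    refine (intervalIntegral.hasFDerivAt_integral_of_dominated_of_fderiv_le
      (F := fun x t => f (x, t)) (bound := fun _ => C)
      (F' := fun x t => fderiv ℝ f (x, t) ∘L ContinuousLinearMap.inl ℝ E ℝ)
      (Metric.closedBall_mem_nhds x₀ one_pos) ?_ ?_ ?_ ?_ ?_ ?_)
    · exact Eventually.of_forall fun x =>
        (hf.continuous.comp (by fun_prop : Continuous fun t : ℝ => (x, t))).aestronglyMeasurable
    · exact (hf.continuous.comp (by fun_prop : Continuous fun t : ℝ => (x₀, t))).intervalIntegrable _ _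
    · exact (hF'.comp (by fun_prop : Continuous fun t : ℝ => (x₀, t))).aestronglyMeasurable
    · refine Eventually.of_forall fun t ht x hx => hC (x, t) ⟨hx, ?_⟩
      rw [Set.uIoc_of_le zero_le_one] at ht
      exact ⟨ht.1.le, ht.2⟩
    · exact intervalIntegrable_const
    · refine Eventually.of_forall fun t _ x _ => ?_
      have h1 : HasFDerivAt (fun y : E => (y, t)) (ContinuousLinearMap.inl ℝ E ℝ) x :=
        hasFDerivAt_prodMk_left x t
      exact ((hf.differentiable (by simp)).differentiableAt (x := (x, t))).hasFDerivAt.comp x h1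
  induction k with
  | zero =>
    intro G _ _ _ f hf
    rw [Nat.cast_zero, contDiff_zero]
    exact continuous_iff_continuousAt.2 fun x => (hderiv hf x).continuousAt
  | succ k ih =>
    intro G _ _ _ f hf
    rw [show ((k + 1 : ℕ) : WithTop ℕ∞) = (k : WithTop ℕ∞) + 1 by simp,
      contDiff_succ_iff_hasFDerivAt]
    refine ⟨_, ih (f := fun z => fderiv ℝ f z ∘L ContinuousLinearMap.inl ℝ E ℝ) ?_, hderiv hf⟩
    exact (hf.fderiv_right (by simp)).clm_comp contDiff_const

/-- Hadamard's lemma: a smooth function is its value at a point plus a smooth family of linear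
forms, applied to the displacement. -/
theorem exists_contDiff_clm_eq {E : Type*} [NormedAddCommGroup E] [NormedSpace ℝ E]
    [FiniteDimensional ℝ E] {h : E → ℝ} (hh : ContDiff ℝ ∞ h) (a : E) :
    ∃ g : E → E →L[ℝ] ℝ, ContDiff ℝ ∞ g ∧ g a = fderiv ℝ h a ∧
      ∀ x, h x = h a + g x (x - a) := by
  have hf : ContDiff ℝ ∞ (fun z : E × ℝ => fderiv ℝ h (a + z.2 • (z.1 - a))) :=
    (hh.fderiv_right (m := ∞) (by simp)).comp (by fun_prop)
  refine ⟨fun x => ∫ t in (0 : ℝ)..1, fderiv ℝ h (a + t • (x - a)), ?_, by simp, fun x => ?_⟩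
  · exact contDiff_infty.2 fun k => contDiff_intervalIntegral_param_nat k hf
  · have hc : Continuous fun t : ℝ => fderiv ℝ h (a + t • (x - a)) :=
      hf.continuous.comp (by fun_prop : Continuous fun t : ℝ => (x, t))
    have h1 : ∀ t ∈ Set.uIcc (0 : ℝ) 1, HasDerivAt (fun t : ℝ => h (a + t • (x - a)))
        (fderiv ℝ h (a + t • (x - a)) (x - a)) t := fun t _ => by
      have h2 : HasDerivAt (fun t : ℝ => a + t • (x - a)) (x - a) t := by
        simpa using ((hasDerivAt_id t).smul_const (x - a)).const_add a
      exact ((hh.differentiable (by simp)).differentiableAt.hasFDerivAt).comp_hasDerivAt t h2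
    have h3 := intervalIntegral.integral_eq_sub_of_hasDerivAt h1
      ((hc.clm_apply continuous_const).intervalIntegrable 0 1)
    simp only
    rw [ContinuousLinearMap.intervalIntegral_apply (hc.intervalIntegrable 0 1), h3]
    simp

end Hadamard

/-! ### Gluing linear coordinates to a smooth vector bundle -/

section LocalFrames

variable {m : ℕ} {M : Type*} [TopologicalSpace M] [ChartedSpace (EuclideanSpace ℝ (Fin m)) M]
  {V : M → Type*} [∀ p, AddCommGroup (V p)] [∀ p, Module ℝ (V p)]

/-- The pretrivialization of a family of vector spaces given by linear coordinates over an open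
set. -/
def pretrivializationOfLinearEquiv {K : Type*} [NormedAddCommGroup K] [NormedSpace ℝ K]
    (U : Set M) (hU : IsOpen U) (e : ∀ p, V p ≃ₗ[ℝ] K) : Pretrivialization K (π K V) where
  toFun v := (v.1, e v.1 v.2)
  invFun x := ⟨x.1, (e x.1).symm x.2⟩
  source := π K V ⁻¹' U
  target := U ×ˢ Set.univ
  map_source' v hv := ⟨hv, trivial⟩
  map_target' x hx := hx.1
  left_inv' v _ := by simp
  right_inv' x _ := by simp
  open_target := hU.prod isOpen_univ
  baseSet := U
  open_baseSet := hU
  source_eq := rfl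
  target_eq := rfl
  proj_toFun _ _ := rfl

instance {K : Type*} [NormedAddCommGroup K] [NormedSpace ℝ K]
    (U : Set M) (hU : IsOpen U) (e : ∀ p, V p ≃ₗ[ℝ] K) :
    (pretrivializationOfLinearEquiv U hU e).IsLinear ℝ :=
  ⟨fun p _ => (e p).toLinearMap.isLinear⟩

theorem pretrivializationOfLinearEquiv_symm {K : Type*} [NormedAddCommGroup K] [NormedSpace ℝ K]
    (U : Set M) (hU : IsOpen U) (e : ∀ p, V p ≃ₗ[ℝ] K) {p : M} (hp : p ∈ U) (v : K) :
    (pretrivializationOfLinearEquiv U hU e).symm p v = (e p).symm v := by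
  rw [Pretrivialization.symm_apply _ hp]
  rfl

/-- A family of vector spaces with a local notion of smooth section, which is described by smooth
coordinates in local linear frames, carries a smooth bundle structure with these smooth
sections. -/
theorem exists_smoothBundleStructure [IsManifold (𝓡 m) ∞ M]
    {E : Type*} [AddCommGroup E] [Module ℝ E] [FiniteDimensional ℝ E]
    (P : (∀ p, V p) → M → Prop)
    (hcongr : ∀ s t q, (∀ᶠ p in 𝓝 q, s p = t p) → P s q → P t q)
    (hP : ∀ p₀ : M, ∃ U : Set M, IsOpen U ∧ p₀ ∈ U ∧ ∃ L : ∀ q, E →ₗ[ℝ] V q, ∀ q ∈ U,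
      Function.Bijective (L q) ∧ ∀ g : M → E, P (fun p => L p (g p)) q ↔ WeaklySmoothAt m g q) :
    ∃ B : SmoothBundleStructure m V, ∀ s q, B.IsSmoothSectionAt s q ↔ P s q := by
  classical
  choose U hUo hU L hL using hP
  let k := Module.finrank ℝ E
  let K := EuclideanSpace ℝ (Fin k)
  let κ : E ≃ₗ[ℝ] K := LinearEquiv.ofFinrankEq E K (by simp [k, K])
  -- Pretrivializations are built from coordinates on all fibres. Outside `U p₀` the frame around
  -- `q` itself supplies an irrelevant default.
  have hiso : ∀ p₀ q, ∃ e : V q ≃ₗ[ℝ] K, q ∈ U p₀ → ∀ v, e.symm v = L p₀ q (κ.symm v) := by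
    intro p₀ q
    by_cases hq : q ∈ U p₀
    · exact ⟨(LinearEquiv.ofBijective (L p₀ q) (hL p₀ q hq).1).symm.trans κ, fun _ v => rfl⟩
    · exact ⟨(LinearEquiv.ofBijective (L q q) (hL q q (hU q)).1).symm.trans κ,
        fun h => absurd h hq⟩
  choose e he using hiso
  have hsec : ∀ p₀ q, q ∈ U p₀ → ∀ s, P s q ↔ ContMDiffAt (𝓡 m) 𝓘(ℝ, K) ∞
      (fun p => e p₀ p (s p)) q := by
    intro p₀ q hq s
    have h1 : ∀ᶠ p in 𝓝 q, L p₀ p (κ.symm (e p₀ p (s p))) = s p := by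
      filter_upwards [(hUo p₀).mem_nhds hq] with p hp
      rw [← he p₀ p hp]; simp
    have h2 : P s q ↔ WeaklySmoothAt m (fun p => κ.symm (e p₀ p (s p))) q := by
      rw [← (hL p₀ q hq).2]
      exact ⟨hcongr _ _ q (h1.mono fun _ h => h.symm), hcongr _ _ q h1⟩
    rw [h2, contMDiffAt_iff_weaklySmoothAt]
    refine ⟨fun h => (h.linearMap κ.toLinearMap).congr (Eventually.of_forall fun p => ?_),
      fun h => h.linearMap κ.symm.toLinearMap⟩
    simp
  let pre : M → Pretrivialization K (π K V) := fun p₀ =>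
    pretrivializationOfLinearEquiv (U p₀) (hUo p₀) (e p₀)
  let f : M → M → M → K →L[ℝ] K := fun p₀ p₁ b =>
    ((e p₀ b).symm.trans (e p₁ b)).toLinearMap.toContinuousLinearMap
  -- A vector held constant in one frame is a section satisfying `P`, so its coordinates in the
  -- other frame are smooth; this is the smoothness of the transition maps.
  have hf : ∀ p₀ p₁, ContMDiffOn (𝓡 m) 𝓘(ℝ, K →L[ℝ] K) ∞ (f p₀ p₁) (U p₀ ∩ U p₁) := by
    intro p₀ p₁ b hb
    refine ContMDiffAt.contMDiffWithinAt ?_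
    rw [contMDiffAt_iff_weaklySmoothAt]
    refine WeaklySmoothAt.of_injective (T := (LinearMap.toContinuousLinearMap).symm.toLinearMap)
      (LinearEquiv.injective _) (WeaklySmoothAt.hom fun v => ?_)
    rw [← contMDiffAt_iff_weaklySmoothAt]
    refine (hsec p₁ b hb.2 (fun p => (e p₀ p).symm v)).1 ((hsec p₀ b hb.1 _).2 ?_)
    simpa using contMDiffAt_const
  have hfv : ∀ p₀ p₁, ∀ b ∈ U p₀ ∩ U p₁, ∀ v, f p₀ p₁ b v = (pre p₁ ⟨b, (pre p₀).symm b v⟩).2 := by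
    intro p₀ p₁ b hb v
    rw [pretrivializationOfLinearEquiv_symm _ _ _ hb.1]
    rfl
  let top : ∀ p, TopologicalSpace (V p) := fun p =>
    TopologicalSpace.induced (e p p) inferInstance
  let a : VectorPrebundle ℝ K V :=
    { pretrivializationAtlas := Set.range pre
      pretrivialization_linear' := by
        rintro _ ⟨p, rfl⟩
        infer_instance
      pretrivializationAt := pre
      mem_base_pretrivializationAt := hU
      pretrivialization_mem_atlas := fun p => ⟨p, rfl⟩
      exists_coordChange := by
        rintro _ ⟨p₀, rfl⟩ _ ⟨p₁, rfl⟩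
        exact ⟨f p₀ p₁, (hf p₀ p₁).continuousOn, hfv p₀ p₁⟩
      totalSpaceMk_isInducing := by
        intro b
        have h1 : IsInducing (e b b) := ⟨rfl⟩
        exact (isInducing_const_prod (x := b)).2 h1 }
  have ha : a.IsContMDiff (𝓡 m) ∞ := ⟨by
    rintro _ ⟨p₀, rfl⟩ _ ⟨p₁, rfl⟩
    exact ⟨f p₀ p₁, hf p₀ p₁, hfv p₀ p₁⟩⟩
  let B : SmoothBundleStructure m V :=
    { rank := k
      topFibre := top
      topTotal := a.totalSpaceTopology
      fiberBundle := a.toFiberBundle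
      vectorBundle := a.toVectorBundle
      smooth := a.contMDiffVectorBundle (𝓡 m) }
  refine ⟨B, fun s q => ?_⟩
  rw [hsec q q (hU q)]
  let := B.topTotal
  let := B.fiberBundle
  have := B.vectorBundle
  have := B.smooth
  exact contMDiffAt_section (IB := 𝓡 m) (n := ∞) (F := K) (E := V) q

end LocalFrames

section Coordinates

variable {m : ℕ} {M : Type*} [TopologicalSpace M] [ChartedSpace (EuclideanSpace ℝ (Fin m)) M]

/-! ### Cut-off functions -/

/-- A smooth bump function supported in a given neighbourhood, equal to one on a smaller open
one. -/
theorem exists_contMDiffMap_eq_one [T2Space M] [IsManifold (𝓡 m) ∞ M] {U : Set M} {p : M}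
    (hU : U ∈ 𝓝 p) : ∃ (χ : C^∞⟮𝓡 m, M; ℝ⟯) (W : Set M), IsOpen W ∧ p ∈ W ∧ W ⊆ U ∧
      (∀ q ∈ W, χ q = 1) ∧ tsupport χ ⊆ U := by
  obtain ⟨f, -, hf⟩ := (SmoothBumpFunction.nhds_basis_tsupport (I := 𝓡 m) p).mem_iff.1 hU
  obtain ⟨W, hW, hWo, hpW⟩ := eventually_nhds_iff.1 f.eventuallyEq_one
  refine ⟨⟨f, f.contMDiff⟩, W, hWo, hpW, fun q hq => hf (subset_tsupport _ ?_), hW, hf⟩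
  simp [hW q hq]

/-- Used to extend functions that are smooth only on a chart domain to global ones. -/
theorem exists_contMDiffMap_eq_mul {U : Set M} (χ : C^∞⟮𝓡 m, M; ℝ⟯)
    (hχ : tsupport χ ⊆ U) {f : M → ℝ} (hf : ∀ p ∈ U, ContMDiffAt (𝓡 m) 𝓘(ℝ, ℝ) ∞ f p) :
    ∃ g : C^∞⟮𝓡 m, M; ℝ⟯, ∀ p, g p = χ p * f p := by
  refine ⟨⟨fun p => χ p * f p, contMDiff_of_tsupport fun p hp => ?_⟩, fun p => rfl⟩
  exact χ.contMDiff.contMDiffAt.mul (hf p (hχ (tsupport_mul_subset_left hp)))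

/-! ### Derivatives along vector fields -/

variable [IsManifold (𝓡 m) ∞ M]

theorem contMDiffAt_mvfderiv_apply {f : M → ℝ} {X : ∀ p : M, TangentSpace (𝓡 m) p} {q : M}
    (hf : ContMDiffAt (𝓡 m) 𝓘(ℝ, ℝ) ∞ f q)
    (hX : ContMDiffAt (𝓡 m) ((𝓡 m).prod 𝓘(ℝ, EuclideanSpace ℝ (Fin m))) ∞
      (fun p => TotalSpace.mk' (EuclideanSpace ℝ (Fin m)) p (X p)) q) :
    ContMDiffAt (𝓡 m) 𝓘(ℝ, ℝ) ∞ (fun p => mvfderiv (𝓡 m) f p (X p)) q := by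
  have h1 := hf.mfderiv_const (m := ∞) (by simp)
  have h2 := ContMDiffAt.clm_apply_of_inCoordinates (F₁ := EuclideanSpace ℝ (Fin m))
    (E₁ := TangentSpace (𝓡 m)) (F₂ := ℝ) (E₂ := TangentSpace 𝓘(ℝ, ℝ)) h1 hX hf
  exact (contMDiff_snd_tangentBundle_modelSpace ℝ 𝓘(ℝ, ℝ) (n := ∞)).contMDiffAt.comp q h2

omit [IsManifold (𝓡 m) ∞ M] in
theorem mvfderiv_congr {f g : M → ℝ} {q : M} (h : f =ᶠ[𝓝 q] g) :
    mvfderiv (𝓡 m) f q = mvfderiv (𝓡 m) g q := by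
  ext v
  have : mfderiv (𝓡 m) 𝓘(ℝ, ℝ) f q = mfderiv (𝓡 m) 𝓘(ℝ, ℝ) g q := h.mfderiv_eq
  exact DFunLike.congr_fun this v

/-- The coordinate functions of a chart. -/
theorem contMDiffAt_extChartAt_apply {p₀ q : M} (hq : q ∈ (chartAt (EuclideanSpace ℝ (Fin m)) p₀).source)
    (j : Fin m) :
    ContMDiffAt (𝓡 m) 𝓘(ℝ, ℝ) ∞ (fun p => extChartAt (𝓡 m) p₀ p j) q :=
  (EuclideanSpace.proj (𝕜 := ℝ) j).contMDiff.contMDiffAt.comp q (contMDiffAt_extChartAt' hq)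

/-! ### Point derivations -/

section PointDerivations

variable [T2Space M] {q : M} {v : C^∞⟮𝓡 m, M; ℝ⟯ →ₗ[ℝ] ℝ}

/-- Take a cut-off function `χ` with `χ(q) = 1`, supported where `f` vanishes. Then `χ f = 0`, and
the Leibniz rule reduces to `v f = 0`. -/
theorem pointDerivation_eq_zero_of_eventually (hv : ∀ f g, v (f * g) = f q * v g + g q * v f)
    {f : C^∞⟮𝓡 m, M; ℝ⟯} (hf : ∀ᶠ p in 𝓝 q, f p = 0) : v f = 0 := by
  obtain ⟨χ, W, -, hqW, -, hχ, hsupp⟩ := exists_contMDiffMap_eq_one (m := m) hf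
  have h0 : χ * f = 0 := by
    ext p
    by_cases hp : f p = 0
    · simp [hp]
    · have : χ p = 0 := image_eq_zero_of_notMem_tsupport fun h => hp (hsupp h)
      simp [this]
  have h1 := hv χ f
  rw [h0, map_zero, hχ q hqW, hf.self_of_nhds] at h1
  simpa using h1.symm

theorem pointDerivation_congr (hv : ∀ f g, v (f * g) = f q * v g + g q * v f)
    {f g : C^∞⟮𝓡 m, M; ℝ⟯} (hf : ∀ᶠ p in 𝓝 q, f p = g p) : v f = v g := by
  rw [← sub_eq_zero, ← map_sub]
  exact pointDerivation_eq_zero_of_eventually hv (hf.mono fun p hp => by simp [hp])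

omit [IsManifold (𝓡 m) ∞ M] [T2Space M] in
theorem pointDerivation_one (hv : ∀ f g, v (f * g) = f q * v g + g q * v f) : v 1 = 0 := by
  have := hv 1 1
  simpa using this

/-- A point derivation annihilates the functions with vanishing differential. -/
theorem pointDerivation_eq_zero (hv : ∀ f g, v (f * g) = f q * v g + g q * v f)
    {f : C^∞⟮𝓡 m, M; ℝ⟯} (hf : mvfderiv (𝓡 m) f q = 0) : v f = 0 := by
  let K := EuclideanSpace ℝ (Fin m)
  let c := extChartAt (𝓡 m) q
  have hct : c.target ∈ 𝓝 (c q) := extChartAt_target_mem_nhds q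
  obtain ⟨ε, hε, hεt⟩ := Metric.nhds_basis_closedBall.mem_iff.1 hct
  -- The support of `ρ` is the closed ball of radius `ε`, which lies in the chart target. So `h` is
  -- smooth on the whole model space and still represents `f` near `q`.
  let ρ : ContDiffBump (c q) := ⟨ε / 2, ε, by positivity, by linarith⟩
  let h : K → ℝ := fun y => ρ y * f (c.symm y)
  have hh : ContDiff ℝ ∞ h := by
    rw [← contMDiff_iff_contDiff]
    refine contMDiff_of_tsupport fun y hy => ?_
    have hy' : y ∈ c.target := hεt (by
      have := tsupport_mul_subset_left hy
      rwa [ρ.tsupport_eq] at this)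
    refine ρ.contDiff.contMDiff.contMDiffAt.mul (f.contMDiff.contMDiffAt.comp y ?_)
    exact (contMDiffOn_extChartAt_symm q).contMDiffAt
      ((isOpen_extChartAt_target q).mem_nhds hy')
  have hcq : q ∈ c.source := mem_extChartAt_source q
  have hcs : c.source ∈ 𝓝 q := extChartAt_source_mem_nhds q
  have hcc : ContinuousAt c q := continuousAt_extChartAt q
  have hfh : ∀ᶠ p in 𝓝 q, f p = h (c p) := by
    filter_upwards [hcs, hcc.eventually ρ.eventuallyEq_one] with p hp hρ
    simp [h, hρ, c.left_inv hp]
  obtain ⟨g, hg, hg0, hgx⟩ := exists_contDiff_clm_eq hh (c q)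
  -- The derivative at `q` of the preferred chart is the identity, so vanishing of `df_q` means
  -- vanishing of the derivative of `h` at `c q`.
  have hgq : g (c q) = 0 := by
    rw [hg0]
    have h1 : mvfderiv (𝓡 m) f q = mvfderiv (𝓡 m) (h ∘ c) q := mvfderiv_congr hfh
    rw [mvfderiv_comp q (hh.differentiable (by simp)).differentiableAt.mdifferentiableAt
      (mdifferentiableAt_extChartAt (mem_chart_source _ q)), mfderiv_extChartAt_self, hf] at h1
    ext w
    have h2 := DFunLike.congr_fun h1 w
    change 0 = mfderiv 𝓘(ℝ, K) 𝓘(ℝ, ℝ) h (c q) w at h2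
    rw [mfderiv_eq_fderiv] at h2
    exact h2.symm
  obtain ⟨χ, W, hWo, hqW, hWU, hχ, hsupp⟩ := exists_contMDiffMap_eq_one (m := m) hcs
  have hsmooth : ∀ j : Fin m, ∃ x : C^∞⟮𝓡 m, M; ℝ⟯, ∀ p, x p = χ p * c p j := fun j =>
    exists_contMDiffMap_eq_mul χ hsupp fun p hp =>
      contMDiffAt_extChartAt_apply (by
        rw [← extChartAt_source (𝓡 m)]; exact hp) j
  have hsmooth' : ∀ j : Fin m, ∃ x : C^∞⟮𝓡 m, M; ℝ⟯,
      ∀ p, x p = χ p * g (c p) (EuclideanSpace.single j 1) := fun j =>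
    exists_contMDiffMap_eq_mul χ hsupp fun p hp => by
      have h1 : ContDiff ℝ ∞ fun y => g y (EuclideanSpace.single j 1) :=
        hg.clm_apply contDiff_const
      exact h1.contMDiff.contMDiffAt.comp p (contMDiffAt_extChartAt' (by
        rw [← extChartAt_source (𝓡 m)]; exact hp))
  choose x hx using hsmooth
  choose G hG using hsmooth'
  -- Hadamard's formula in global functions: near `q`, `f` is a constant plus a sum of products in
  -- which both factors vanish at `q`. The Leibniz rule annihilates each product.
  have hsum : ∀ᶠ p in 𝓝 q, f p
      = (f q • (1 : C^∞⟮𝓡 m, M; ℝ⟯) + ∑ j, (x j - x j q • (1 : C^∞⟮𝓡 m, M; ℝ⟯)) * G j) p := by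
    filter_upwards [hfh, hWo.mem_nhds hqW] with p hp hpW
    have h1 : ∀ j, (x j - x j q • (1 : C^∞⟮𝓡 m, M; ℝ⟯)) p = c p j - c q j := fun j => by
      simp [hx, hχ p hpW, hχ q hqW]
    have h2 : (∑ j, (x j - x j q • (1 : C^∞⟮𝓡 m, M; ℝ⟯)) * G j) p
        = ∑ j, (c p j - c q j) * g (c p) (EuclideanSpace.single j 1) := by
      rw [← ContMDiffMap.coeFnRingHom_apply, map_sum, Finset.sum_apply]
      refine Finset.sum_congr rfl fun j _ => ?_
      rw [← h1 j]
      simp [hG, hχ p hpW]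
    have h3 : g (c p) (c p - c q)
        = ∑ j, (c p j - c q j) * g (c p) (EuclideanSpace.single j 1) := by
      have h4 := (EuclideanSpace.basisFun (Fin m) ℝ).sum_repr (c p - c q)
      conv_lhs => rw [← h4]
      simp
    rw [ContMDiffMap.coe_add, Pi.add_apply, h2, ← h3, hp, hgx (c p), ← hfh.self_of_nhds]
    simp
  rw [pointDerivation_congr hv hsum]
  simp [hv, pointDerivation_one hv, hG, hgq]

end PointDerivations

/-- Local coordinates, extended to global smooth functions, with their coordinate vector fields. -/
theorem exists_localCoordinates [T2Space M] (p₀ : M) :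
    ∃ (U : Set M) (x : Fin m → C^∞⟮𝓡 m, M; ℝ⟯)
      (X : Fin m → Cₛ^∞⟮𝓡 m; EuclideanSpace ℝ (Fin m), fun p : M => TangentSpace (𝓡 m) p⟯),
      IsOpen U ∧ p₀ ∈ U ∧
      ∀ q ∈ U, ∀ i j, mvfderiv (𝓡 m) (x i) q (X j q) = if i = j then 1 else 0 := by
  let K := EuclideanSpace ℝ (Fin m)
  let c := extChartAt (𝓡 m) p₀
  let e := trivializationAt K (fun p : M => TangentSpace (𝓡 m) p) p₀
  have hbase : e.baseSet = c.source := by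
    rw [TangentBundle.trivializationAt_baseSet, extChartAt_source]
  have hcs : c.source ∈ 𝓝 p₀ := extChartAt_source_mem_nhds p₀
  obtain ⟨χ, W, hWo, hqW, hWU, hχ, hsupp⟩ := exists_contMDiffMap_eq_one (m := m) hcs
  have hsmooth : ∀ j : Fin m, ∃ x : C^∞⟮𝓡 m, M; ℝ⟯, ∀ p, x p = χ p * c p j := fun j =>
    exists_contMDiffMap_eq_mul χ hsupp fun p hp =>
      contMDiffAt_extChartAt_apply (by
        rw [← extChartAt_source (𝓡 m)]; exact hp) j
  choose x hx using hsmooth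
  have hX : ∀ j : Fin m, ContMDiff (𝓡 m) ((𝓡 m).prod 𝓘(ℝ, K)) ∞
      (fun p => TotalSpace.mk' K p (χ p • e.symmL ℝ p (EuclideanSpace.single j 1))) := by
    intro j
    refine ContMDiffOn.smul_section_of_tsupport (u := c.source) χ.contMDiff.contMDiffOn
      (isOpen_extChartAt_source p₀) hsupp ?_
    intro p hp
    refine ContMDiffAt.contMDiffWithinAt ((e.contMDiffAt_section_iff (hbase ▸ hp)).2 ?_)
    refine (contMDiffAt_const (c := EuclideanSpace.single j (1 : ℝ))).congr_of_eventuallyEq ?_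
    filter_upwards [e.open_baseSet.mem_nhds (hbase ▸ hp)] with p' hp'
    rw [e.symmL_apply hp']
    exact congrArg Prod.snd (e.apply_mk_symm hp' _)
  refine ⟨W, x, fun j => ⟨_, hX j⟩, hWo, hqW, fun q hq i j => ?_⟩
  have hqs : q ∈ (chartAt K p₀).source := by
    rw [← extChartAt_source (𝓡 m)]; exact hWU hq
  have h1 : mvfderiv (𝓡 m) (x i) q
      = mvfderiv (𝓡 m) ((EuclideanSpace.proj (𝕜 := ℝ) i : K →L[ℝ] ℝ) ∘ c) q := by
    refine mvfderiv_congr ?_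
    filter_upwards [hWo.mem_nhds hq] with p hp
    simp [hx, hχ p hp]
  rw [h1, mvfderiv_comp q
    (EuclideanSpace.proj (𝕜 := ℝ) i : K →L[ℝ] ℝ).differentiableAt.mdifferentiableAt
    (mdifferentiableAt_extChartAt hqs)]
  -- Over its source, the derivative of the chart is the tangent bundle trivialization, and it
  -- therefore undoes `symmL`.
  have h2 : mfderiv (𝓡 m) 𝓘(ℝ, K) c q (χ q • e.symmL ℝ q (EuclideanSpace.single j 1))
      = (EuclideanSpace.single j 1 : K) := by
    rw [hχ q hq, one_smul, ← TangentBundle.continuousLinearMapAt_trivializationAt hqs]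
    exact e.continuousLinearMapAt_symmL (hbase ▸ hWU hq) _
  change mfderiv 𝓘(ℝ, K) 𝓘(ℝ, ℝ) (EuclideanSpace.proj (𝕜 := ℝ) i : K →L[ℝ] ℝ) (c q)
    (mfderiv (𝓡 m) 𝓘(ℝ, K) c q (χ q • e.symmL ℝ q (EuclideanSpace.single j 1))) = _
  rw [h2, mfderiv_eq_fderiv, ContinuousLinearMap.fderiv]
  change (EuclideanSpace.single j (1 : ℝ) : K) i = _
  simp

end Coordinates

/-! ### Supercommutativity of the exterior algebra -/

section Exterior

variable {V : Type*} [AddCommGroup V] [Module ℝ V]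

/-- Generators anticommute, so moving one past a product costs one sign per factor, which is what
the grade involution records. -/
theorem exteriorAlgebra_ι_mul (v : V) (a : ExteriorAlgebra ℝ V) :
    ExteriorAlgebra.ι ℝ v * a = CliffordAlgebra.involute a * ExteriorAlgebra.ι ℝ v := by
  induction a using CliffordAlgebra.induction with
  | algebraMap r => rw [AlgHom.commutes, Algebra.commutes]
  | ι w =>
    rw [CliffordAlgebra.involute_ι, neg_mul]
    exact eq_neg_of_add_eq_zero_left (ExteriorAlgebra.ι_add_mul_swap v w)
  | mul a b ha hb => rw [← mul_assoc, ha, mul_assoc, hb, map_mul, mul_assoc]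
  | add a b ha hb => rw [mul_add, ha, hb, map_add, add_mul]

theorem exteriorAlgebra_mul_of_even {a : ExteriorAlgebra ℝ V}
    (ha : a ∈ CliffordAlgebra.evenOdd (0 : QuadraticForm ℝ V) 0) (b : ExteriorAlgebra ℝ V) :
    a * b = b * a := by
  induction a, ha using CliffordAlgebra.even_induction with
  | algebraMap r => exact Algebra.commutes r b
  | add x y _ _ hx hy => rw [add_mul, mul_add, hx, hy]
  | ι_mul_ι_mul v w x _ hx =>
    have h2 := exteriorAlgebra_ι_mul w b
    have h1 := exteriorAlgebra_ι_mul v (CliffordAlgebra.involute b)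
    rw [CliffordAlgebra.involute_involute] at h1
    calc _ = ExteriorAlgebra.ι ℝ v * (ExteriorAlgebra.ι ℝ w * (x * b)) := by
          simp only [mul_assoc]
      _ = ExteriorAlgebra.ι ℝ v * (ExteriorAlgebra.ι ℝ w * b) * x := by
          rw [hx]; simp only [mul_assoc]
      _ = _ := by rw [h2, ← mul_assoc, h1]; simp only [mul_assoc]

theorem exteriorAlgebra_mul_of_odd {a : ExteriorAlgebra ℝ V}
    (ha : a ∈ CliffordAlgebra.evenOdd (0 : QuadraticForm ℝ V) 1) (b : ExteriorAlgebra ℝ V) :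
    a * b = CliffordAlgebra.involute b * a := by
  induction a, ha using CliffordAlgebra.odd_induction with
  | ι v => exact exteriorAlgebra_ι_mul v b
  | add x y _ _ hx hy => rw [add_mul, mul_add, hx, hy]
  | ι_mul_ι_mul v w x _ hx =>
    have h2 := exteriorAlgebra_ι_mul w (CliffordAlgebra.involute b)
    have h1 := exteriorAlgebra_ι_mul v b
    rw [CliffordAlgebra.involute_involute] at h2
    calc _ = ExteriorAlgebra.ι ℝ v * (ExteriorAlgebra.ι ℝ w * (x * b)) := by
          simp only [mul_assoc]
      _ = ExteriorAlgebra.ι ℝ v * (ExteriorAlgebra.ι ℝ w * CliffordAlgebra.involute b) * x := by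
          rw [hx]; simp only [mul_assoc]
      _ = _ := by rw [h2, ← mul_assoc, h1]; simp only [mul_assoc]

theorem exteriorAlgebra_supercomm {i j : ZMod 2} {a b : ExteriorAlgebra ℝ V}
    (ha : a ∈ CliffordAlgebra.evenOdd (0 : QuadraticForm ℝ V) i)
    (hb : b ∈ CliffordAlgebra.evenOdd (0 : QuadraticForm ℝ V) j) :
    a * b = (-1 : ℝ) ^ (i * j).val • (b * a) := by
  have hz : ∀ k : ZMod 2, k = 0 ∨ k = 1 := by decide
  rcases hz i with rfl | rfl
  · simp [exteriorAlgebra_mul_of_even ha b]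
  · rw [exteriorAlgebra_mul_of_odd ha b]
    rcases hz j with rfl | rfl
    · simp [CliffordAlgebra.involute_eq_of_mem_even hb]
    · simp [CliffordAlgebra.involute_eq_of_mem_odd hb, ZMod.val_one]

/-- Supercommutativity gives `a * a = -(a * a)`, and 2 is invertible. -/
theorem exteriorAlgebra_odd_mul_self {a : ExteriorAlgebra ℝ V}
    (ha : a ∈ CliffordAlgebra.evenOdd (0 : QuadraticForm ℝ V) 1) : a * a = 0 := by
  have h := exteriorAlgebra_mul_of_odd ha a
  rw [CliffordAlgebra.involute_eq_of_mem_odd ha, neg_mul] at h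
  have h2 : (2 : ℝ) • (a * a) = 0 := by
    rw [two_smul]
    nth_rewrite 1 [h]
    exact neg_add_cancel _
  exact (smul_eq_zero.1 h2).resolve_left two_ne_zero

end Exterior

/-! ### Superderivations -/

section Superderivations

variable {A : Type*} [Ring A] [Algebra ℝ A] {B : Type*} [Ring B] [Algebra ℝ B]

theorem graded_proj_add (𝒜 : ZMod 2 → Submodule ℝ A) [GradedAlgebra 𝒜] (a : A) :
    GradedRing.proj 𝒜 0 a + GradedRing.proj 𝒜 1 a = a := by
  classical
  have h := DirectSum.sum_support_decompose 𝒜 a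
  rw [Finset.sum_subset (Finset.subset_univ _) fun i _ hi => by simpa using hi] at h
  exact (Fin.sum_univ_two _).symm.trans h

theorem exists_parity_of_mem_sder {𝒜 : ZMod 2 → Submodule ℝ A} {D : A →ₗ[ℝ] A} (hD : D ∈ sder 𝒜) :
    ∃ D' : ZMod 2 → A →ₗ[ℝ] A, (∀ k, D' k ∈ superderivationsOfParity 𝒜 k) ∧ D = D' 0 + D' 1 := by
  obtain ⟨D₀, h₀, D₁, h₁, rfl⟩ := Submodule.mem_sup.1 hD
  refine ⟨![D₀, D₁], fun k => ?_, rfl⟩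
  fin_cases k
  · exact h₀
  · exact h₁

theorem superderivationsOfParity_le_sder (𝒜 : ZMod 2 → Submodule ℝ A) (k : ZMod 2) :
    superderivationsOfParity 𝒜 k ≤ sder 𝒜 := by
  fin_cases k
  · exact le_sup_left
  · exact le_sup_right

theorem mem_sder_induction {𝒜 : ZMod 2 → Submodule ℝ A} {p : (A →ₗ[ℝ] A) → Prop}
    (h : ∀ k, ∀ D ∈ superderivationsOfParity 𝒜 k, p D) (hadd : ∀ D D', p D → p D' → p (D + D'))
    {D : A →ₗ[ℝ] A} (hD : D ∈ sder 𝒜) : p D := by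
  obtain ⟨D', h', rfl⟩ := exists_parity_of_mem_sder hD
  exact hadd _ _ (h 0 _ (h' 0)) (h 1 _ (h' 1))

/-- The exponent in the sign contains the parity of `a` as a factor, so the parity of `D` is
irrelevant and `b` may be inhomogeneous. -/
theorem superderivation_mul_of_even {𝒜 : ZMod 2 → Submodule ℝ A}
    (hdec : ∀ b, ∃ b₀ ∈ 𝒜 0, ∃ b₁ ∈ 𝒜 1, b = b₀ + b₁) {D : A →ₗ[ℝ] A} (hD : D ∈ sder 𝒜)
    {a : A} (ha : a ∈ 𝒜 0) (b : A) : D (a * b) = D a * b + a * D b := by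
  revert D
  refine fun {D} hD => mem_sder_induction (p := fun D => D (a * b) = D a * b + a * D b)
    (fun k D hD => ?_) (fun D D' h h' => ?_) hD
  · obtain ⟨b₀, h₀, b₁, h₁, rfl⟩ := hdec b
    rw [mul_add, map_add, hD.2 0 0 a ha b₀ h₀, hD.2 0 1 a ha b₁ h₁]
    simp only [zero_mul, ZMod.val_zero, pow_zero, one_smul, map_add, mul_add]
    abel
  · simp only [LinearMap.add_apply, h, h', add_mul, mul_add]
    abel

theorem sder_apply_one {𝒜 : ZMod 2 → Submodule ℝ A}
    (h1 : (1 : A) ∈ 𝒜 0) {D : A →ₗ[ℝ] A} (hD : D ∈ sder 𝒜) : D 1 = 0 := by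
  refine mem_sder_induction (p := fun D => D 1 = 0) (fun k D hD => ?_)
    (fun D D' h h' => by simp [h, h']) hD
  have := hD.2 0 0 1 h1 1 h1
  simpa using this

theorem conj_mem_superderivationsOfParity {𝒜 : ZMod 2 → Submodule ℝ A} {ℬ : ZMod 2 → Submodule ℝ B}
    (φ : A ≃ₐ[ℝ] B) (hφ : ∀ i a, φ a ∈ ℬ i ↔ a ∈ 𝒜 i) {k : ZMod 2} {D : A →ₗ[ℝ] A}
    (hD : D ∈ superderivationsOfParity 𝒜 k) :
    φ.toLinearEquiv.conj D ∈ superderivationsOfParity ℬ k := by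
  have hs : ∀ i b, b ∈ ℬ i → φ.symm b ∈ 𝒜 i := fun i b hb => by
    rw [← hφ]; simpa using hb
  refine ⟨fun i b hb => (hφ _ _).2 (hD.1 i _ (hs i b hb)), fun i j a ha b hb => ?_⟩
  change φ (D (φ.symm (a * b))) = φ (D (φ.symm a)) * b + _ • (a * φ (D (φ.symm b)))
  rw [map_mul, hD.2 i j _ (hs i a ha) _ (hs j b hb)]
  simp

theorem conj_mem_sder {𝒜 : ZMod 2 → Submodule ℝ A} {ℬ : ZMod 2 → Submodule ℝ B}
    (φ : A ≃ₐ[ℝ] B) (hφ : ∀ i a, φ a ∈ ℬ i ↔ a ∈ 𝒜 i) {D : A →ₗ[ℝ] A} (hD : D ∈ sder 𝒜) :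
    φ.toLinearEquiv.conj D ∈ sder ℬ := by
  refine mem_sder_induction (p := fun D => φ.toLinearEquiv.conj D ∈ sder ℬ) (fun k D hD => ?_)
    (fun D D' h h' => ?_) hD
  · exact superderivationsOfParity_le_sder _ k (conj_mem_superderivationsOfParity φ hφ hD)
  · rw [map_add]; exact add_mem h h'

/-- Graded isomorphisms induce isomorphisms of the spaces of superderivations. -/
def sderConj {𝒜 : ZMod 2 → Submodule ℝ A} {ℬ : ZMod 2 → Submodule ℝ B}
    (φ : A ≃ₐ[ℝ] B) (hφ : ∀ i a, φ a ∈ ℬ i ↔ a ∈ 𝒜 i) : sder 𝒜 ≃ₗ[ℝ] sder ℬ :=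
  φ.toLinearEquiv.conj.ofSubmodules _ _ <| by
    have hφ' : ∀ i b, φ.symm b ∈ 𝒜 i ↔ b ∈ ℬ i := fun i b => by rw [← hφ]; simp
    refine le_antisymm (Submodule.map_le_iff_le_comap.2 fun D hD => conj_mem_sder φ hφ hD)
      fun D hD => ⟨_, conj_mem_sder φ.symm hφ' hD, ?_⟩
    ext b
    simp [LinearEquiv.conj_apply]

theorem sderConj_apply {𝒜 : ZMod 2 → Submodule ℝ A} {ℬ : ZMod 2 → Submodule ℝ B}
    (φ : A ≃ₐ[ℝ] B) (hφ : ∀ i a, φ a ∈ ℬ i ↔ a ∈ 𝒜 i) (D : sder 𝒜) (b : B) :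
    (sderConj φ hφ D).1 b = φ (D.1 (φ.symm b)) := rfl

end Superderivations

/-! ### The Grassmann algebra -/

/-- The free supercommutative algebra on `n` odd generators. -/
abbrev Grassmann (n : ℕ) : Type := ExteriorAlgebra ℝ (Fin n → ℝ)

/-- The parity grading of the Grassmann algebra. -/
abbrev grassmannParity (n : ℕ) (i : ZMod 2) : Submodule ℝ (Grassmann n) :=
  CliffordAlgebra.evenOdd (0 : QuadraticForm ℝ (Fin n → ℝ)) i

instance finiteDimensional_grassmann (n : ℕ) : FiniteDimensional ℝ (Grassmann n) := by
  classical
  refine ⟨?_⟩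
  have h : (⊤ : Submodule ℝ (Grassmann n)) = ⨆ i ∈ Finset.range (n + 1), ⋀[ℝ]^i (Fin n → ℝ) := by
    refine le_antisymm (fun a _ => ?_) le_top
    rw [← DirectSum.sum_support_decompose (fun i : ℕ => ⋀[ℝ]^i (Fin n → ℝ)) a]
    refine Submodule.sum_mem _ fun i hi => ?_
    -- Exterior powers of degree above `n` vanish, their dimension being the binomial coefficient.
    have hin : i ∈ Finset.range (n + 1) := by
      by_contra hin
      have h0 : Module.finrank ℝ (⋀[ℝ]^i (Fin n → ℝ)) = 0 := by
        rw [exteriorPower.finrank_eq, Module.finrank_fin_fun]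
        exact Nat.choose_eq_zero_of_lt (by simpa using hin)
      have : Subsingleton (⋀[ℝ]^i (Fin n → ℝ)) := Module.finrank_zero_iff.1 h0
      exact (DFinsupp.mem_support_iff.1 hi) (Subsingleton.elim _ _)
    exact Submodule.mem_iSup_of_mem i (Submodule.mem_iSup_of_mem hin (Subtype.mem _))
  rw [h]
  exact Submodule.fg_biSup _ _ fun i _ => Module.Finite.iff_fg.1 inferInstance

theorem graded_proj_of_mem {A : Type*} [Ring A] [Algebra ℝ A] {𝒜 : ZMod 2 → Submodule ℝ A}
    [GradedAlgebra 𝒜] {i : ZMod 2} {a : A} (ha : a ∈ 𝒜 i) : GradedRing.proj 𝒜 i a = a :=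
  DirectSum.decompose_of_mem_same _ ha

theorem graded_proj_of_mem_ne {A : Type*} [Ring A] [Algebra ℝ A] {𝒜 : ZMod 2 → Submodule ℝ A}
    [GradedAlgebra 𝒜] {i j : ZMod 2} {a : A} (ha : a ∈ 𝒜 i) (hij : i ≠ j) :
    GradedRing.proj 𝒜 j a = 0 :=
  DirectSum.decompose_of_mem_ne _ ha hij

/-- A grade-preserving map commutes with the homogeneous projections; injectivity then identifies
`a` with its own component. -/
theorem mem_iff_of_graded_of_injective {A B : Type*} [Ring A] [Algebra ℝ A] [Ring B] [Algebra ℝ B]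
    {𝒜 : ZMod 2 → Submodule ℝ A} [GradedAlgebra 𝒜] {ℬ : ZMod 2 → Submodule ℝ B} [GradedAlgebra ℬ]
    (f : A →ₗ[ℝ] B) (hf : ∀ i, ∀ a ∈ 𝒜 i, f a ∈ ℬ i) (hinj : Function.Injective f)
    (i : ZMod 2) (a : A) : f a ∈ ℬ i ↔ a ∈ 𝒜 i := by
  refine ⟨fun h => ?_, hf i a⟩
  have hcomm : GradedRing.proj ℬ i (f a) = f (GradedRing.proj 𝒜 i a) := by
    conv_lhs => rw [← graded_proj_add 𝒜 a, map_add, map_add]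
    have h0 : f (GradedRing.proj 𝒜 0 a) ∈ ℬ 0 := hf 0 _ (SetLike.coe_mem _)
    have h1 : f (GradedRing.proj 𝒜 1 a) ∈ ℬ 1 := hf 1 _ (SetLike.coe_mem _)
    have hz : ∀ k : ZMod 2, k = 0 ∨ k = 1 := by decide
    rcases hz i with rfl | rfl
    · rw [graded_proj_of_mem h0, graded_proj_of_mem_ne h1 (by decide), add_zero]
    · rw [graded_proj_of_mem h1, graded_proj_of_mem_ne h0 (by decide), zero_add]
  rw [graded_proj_of_mem h] at hcomm
  rw [hinj hcomm]
  exact SetLike.coe_mem _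

/-! ### Local frames of a supermanifold -/

section SuperFrames

variable {m n : ℕ} {M : Type*} [TopologicalSpace M] [ChartedSpace (EuclideanSpace ℝ (Fin m)) M]
  [IsManifold (𝓡 m) ∞ M]
  {F : Type*} [NormedAddCommGroup F] [NormedSpace ℝ F] [FiniteDimensional ℝ F] {R : M → Type*}
  [∀ p, Ring (R p)] [∀ p, Algebra ℝ (R p)]
  [TopologicalSpace (TotalSpace F R)] [∀ p, TopologicalSpace (R p)] [FiberBundle F R]
  [VectorBundle ℝ F R] [ContMDiffVectorBundle ∞ F R (𝓡 m)]
  {𝒜 : ∀ p, ZMod 2 → Submodule ℝ (R p)} [∀ p, GradedAlgebra (𝒜 p)]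
  [IsSmoothAlgebraBundle m F R]

variable (m F) in
/-- Smoothness of a section of `R` at a point. -/
abbrev SmoothSectionAt (s : ∀ p, R p) (q : M) : Prop :=
  ContMDiffAt (𝓡 m) ((𝓡 m).prod 𝓘(ℝ, F)) ∞ (fun p => TotalSpace.mk' F p (s p)) q

omit [IsManifold (𝓡 m) ∞ M] [FiniteDimensional ℝ F] [ContMDiffVectorBundle ∞ F R (𝓡 m)] in
theorem IsSupermanifold.exists_gradedEquiv (hR : IsSupermanifold m n F R 𝒜) (q : M) :
    ∃ φ : Grassmann n ≃ₐ[ℝ] R q, ∀ i a, φ a ∈ 𝒜 q i ↔ a ∈ grassmannParity n i := by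
  obtain ⟨φ, hφ⟩ := hR.free q
  refine ⟨φ, fun i a => ?_⟩
  rw [← hφ i]
  exact ⟨fun ⟨b, hb, hba⟩ => φ.injective hba ▸ hb, fun ha => ⟨a, ha, rfl⟩⟩

omit [IsManifold (𝓡 m) ∞ M] [FiniteDimensional ℝ F] [ContMDiffVectorBundle ∞ F R (𝓡 m)] in
theorem IsSupermanifold.odd_mul_self (hR : IsSupermanifold m n F R 𝒜) {q : M} {a : R q}
    (ha : a ∈ 𝒜 q 1) : a * a = 0 := by
  obtain ⟨φ, hφ⟩ := hR.exists_gradedEquiv q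
  obtain ⟨b, rfl⟩ := φ.surjective a
  rw [← map_mul, exteriorAlgebra_odd_mul_self ((hφ 1 b).1 ha), map_zero]

omit [IsManifold (𝓡 m) ∞ M] [FiniteDimensional ℝ F] [ContMDiffVectorBundle ∞ F R (𝓡 m)] in
/-- Algebra homomorphisms from the Grassmann algebra which are smooth on generators are smooth. -/
theorem smoothSectionAt_of_generators {q : M} (f : ∀ p, Grassmann n →ₐ[ℝ] R p)
    (hf : ∀ v, SmoothSectionAt m F (fun p => f p (ExteriorAlgebra.ι ℝ v)) q) (a : Grassmann n) :
    SmoothSectionAt m F (fun p => f p a) q := by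
  induction a using CliffordAlgebra.induction with
  | algebraMap r =>
    simp only [AlgHom.commutes]
    simp only [Algebra.algebraMap_eq_smul_one]
    exact ContMDiffAt.const_smul_section (s := fun p => (1 : R p))
      (IsSmoothAlgebraBundle.contMDiff_one (m := m) (F := F) (R := R)).contMDiffAt
  | ι v => exact hf v
  | mul a b ha hb =>
    simp only [map_mul]
    exact IsSmoothAlgebraBundle.contMDiffAt_mul _ _ q ha hb
  | add a b ha hb =>
    simp only [map_add]
    exact ha.add_section hb

omit [IsManifold (𝓡 m) ∞ M] [IsSmoothAlgebraBundle m F R] in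
/-- A family of linear maps from a fixed space to the fibres of a bundle, smooth on constants and
bijective at a point, is a local frame near that point. -/
theorem exists_frame_of_bijective {E : Type*} [AddCommGroup E] [Module ℝ E] [FiniteDimensional ℝ E]
    {U₀ : Set M} (hU₀ : IsOpen U₀) {p₀ : M} (hp₀ : p₀ ∈ U₀) (f : ∀ p, E →ₗ[ℝ] R p)
    (hf : ∀ v, ∀ q ∈ U₀, SmoothSectionAt m F (fun p => f p v) q)
    (hbij : Function.Bijective (f p₀)) :
    ∃ U : Set M, IsOpen U ∧ p₀ ∈ U ∧ ∀ q ∈ U, Function.Bijective (f q) ∧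
      ∀ g : M → E, SmoothSectionAt m F (fun p => f p (g p)) q ↔ WeaklySmoothAt m g q := by
  let e := trivializationAt F R p₀
  have hpe : p₀ ∈ e.baseSet := FiberBundle.mem_baseSet_trivializationAt' p₀
  let κ : F ≃ₗ[ℝ] E := ((LinearEquiv.ofBijective (f p₀) hbij).trans
    (e.continuousLinearEquivAt ℝ p₀ hpe).toLinearEquiv).symm
  -- The frame read in a trivialization and normalized to be the identity at `p₀`. Near `p₀` it
  -- remains invertible, units being open, and inversion is smooth.
  let T : M → F →L[ℝ] F := fun p =>
    (e.linearMapAt ℝ p ∘ₗ f p ∘ₗ κ.toLinearMap).toContinuousLinearMap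
  have hlin : ∀ p ∈ e.baseSet, ∀ w : R p, e.linearMapAt ℝ p w = (e ⟨p, w⟩).2 := fun p hp w => by
    rw [e.linearMapAt_apply]; exact if_pos hp
  have hinj : ∀ p ∈ e.baseSet, Function.Bijective (e.linearMapAt ℝ p) := fun p hp => by
    have := (e.continuousLinearEquivAt ℝ p hp).bijective
    convert this using 1
    ext w
    exact hlin p hp w
  have hT : ∀ q ∈ U₀ ∩ e.baseSet, ContMDiffAt (𝓡 m) 𝓘(ℝ, F →L[ℝ] F) ∞ T q := by
    intro q hq
    rw [contMDiffAt_iff_weaklySmoothAt]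
    refine WeaklySmoothAt.of_injective (T := (LinearMap.toContinuousLinearMap).symm.toLinearMap)
      (LinearEquiv.injective _) (WeaklySmoothAt.hom fun v => ?_)
    rw [← contMDiffAt_iff_weaklySmoothAt]
    refine ((e.contMDiffAt_section_iff hq.2).1 (hf (κ v) q hq.1)).congr_of_eventuallyEq ?_
    filter_upwards [e.open_baseSet.mem_nhds hq.2] with p hp
    exact hlin p hp _
  have hTp₀ : IsUnit (T p₀) := by
    have : T p₀ = 1 := by
      ext v
      have h1 : (e.continuousLinearEquivAt ℝ p₀ hpe) (f p₀ (κ v)) = v := κ.symm_apply_apply v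
      have h2 : T p₀ v = (e.continuousLinearEquivAt ℝ p₀ hpe) (f p₀ (κ v)) := hlin p₀ hpe _
      rw [h2, h1]; rfl
    rw [this]; exact isUnit_one
  have hopen : IsOpen (U₀ ∩ e.baseSet ∩ T ⁻¹' {A | IsUnit A}) := by
    refine ContinuousOn.isOpen_inter_preimage
      (fun q hq => (hT q hq).continuousAt.continuousWithinAt) (hU₀.inter e.open_baseSet) ?_
    exact Units.isOpen
  refine ⟨_, hopen, ⟨⟨hp₀, hpe⟩, hTp₀⟩, fun q hq => ⟨?_, fun g => ?_⟩⟩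
  · have h1 : Function.Bijective (T q) := by
      obtain ⟨u, hu⟩ := hq.2
      rw [← hu]
      exact (ContinuousLinearEquiv.ofUnit u).bijective
    have h2 : ⇑(T q) = e.linearMapAt ℝ q ∘ (f q ∘ κ) := rfl
    rw [h2, (hinj q hq.1.2).of_comp_iff', Function.Bijective.of_comp_iff _ κ.bijective] at h1
    exact h1
  · have h1 : SmoothSectionAt m F (fun p => f p (g p)) q ↔
        ContMDiffAt (𝓡 m) 𝓘(ℝ, F) ∞ (fun p => T p (κ.symm (g p))) q := by
      refine (e.contMDiffAt_section_iff hq.1.2).trans (Filter.EventuallyEq.contMDiffAt_iff ?_)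
      filter_upwards [e.open_baseSet.mem_nhds hq.1.2] with p hp
      simp only [T, LinearMap.coe_toContinuousLinearMap', LinearMap.comp_apply,
        LinearEquiv.coe_coe, LinearEquiv.apply_symm_apply]
      exact (hlin p hp _).symm
    have h2 : ContMDiffAt (𝓡 m) 𝓘(ℝ, F) ∞ (fun p => T p (κ.symm (g p))) q ↔
        ContMDiffAt (𝓡 m) 𝓘(ℝ, F) ∞ (fun p => κ.symm (g p)) q := by
      refine ⟨fun h => ?_, fun h => (hT q hq.1).clm_apply h⟩
      have hinv : ContMDiffAt (𝓡 m) 𝓘(ℝ, F →L[ℝ] F) ∞ (fun p => Ring.inverse (T p)) q := by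
        obtain ⟨u, hu⟩ := hq.2
        have := contDiffAt_ringInverse ℝ (n := ∞) u
        rw [hu] at this
        exact this.contMDiffAt.comp q (hT q hq.1)
      refine (hinv.clm_apply h).congr_of_eventuallyEq ?_
      filter_upwards [hopen.mem_nhds hq] with p hp
      rw [← mul_apply_eq_comp, Ring.inverse_mul_cancel _ hp.2]
      rfl
    rw [h1, h2, contMDiffAt_iff_weaklySmoothAt]
    refine ⟨fun h => (h.linearMap κ.toLinearMap).congr (Eventually.of_forall fun p => ?_),
      fun h => h.linearMap κ.symm.toLinearMap⟩
    simp

omit [IsManifold (𝓡 m) ∞ M] in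
/-- Near every point a supermanifold is trivial as a bundle of superalgebras. -/
theorem exists_superFrame (hR : IsSupermanifold m n F R 𝒜) (p₀ : M) :
    ∃ (U : Set M) (φ : ∀ q, Grassmann n ≃ₐ[ℝ] R q), IsOpen U ∧ p₀ ∈ U ∧
      (∀ q i a, φ q a ∈ 𝒜 q i ↔ a ∈ grassmannParity n i) ∧
      ∀ q ∈ U, ∀ s : ∀ p, R p, SmoothSectionAt m F s q ↔
        WeaklySmoothAt m (fun p => (φ p).symm (s p)) q := by
  classical
  obtain ⟨φ₀, hφ₀⟩ := hR.exists_gradedEquiv p₀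
  let e := trivializationAt F R p₀
  have hpe : p₀ ∈ e.baseSet := FiberBundle.mem_baseSet_trivializationAt' p₀
  -- The images of the generators at `p₀`, continued constantly in the trivialization. The constant
  -- continuation need not be odd; projecting makes the squares vanish, as the universal property
  -- requires.
  let θ : ∀ p, (Fin n → ℝ) →ₗ[ℝ] R p := fun p =>
    GradedAlgebra.proj (𝒜 p) 1 ∘ₗ e.symmₗ ℝ p ∘ₗ e.linearMapAt ℝ p₀ ∘ₗ
      φ₀.toLinearMap ∘ₗ ExteriorAlgebra.ι ℝ
  have hodd : ∀ p v, θ p v ∈ 𝒜 p 1 := fun p v => SetLike.coe_mem _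
  let f : ∀ p, Grassmann n →ₐ[ℝ] R p := fun p =>
    ExteriorAlgebra.lift ℝ ⟨θ p, fun v => hR.odd_mul_self (hodd p v)⟩
  have hfι : ∀ p v, f p (ExteriorAlgebra.ι ℝ v) = θ p v := fun p v =>
    ExteriorAlgebra.lift_ι_apply ℝ _ _ v
  have hsmooth : ∀ a, ∀ q ∈ e.baseSet, SmoothSectionAt m F (fun p => f p a) q := by
    intro a q hq
    refine smoothSectionAt_of_generators f (fun v => ?_) a
    simp only [hfι]
    refine hR.contMDiffAt_component 1 _ q ((e.contMDiffAt_section_iff hq).2 ?_)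
    refine (contMDiffAt_const (c := e.linearMapAt ℝ p₀
      (φ₀ (ExteriorAlgebra.ι ℝ v)))).congr_of_eventuallyEq ?_
    filter_upwards [e.open_baseSet.mem_nhds hq] with p hp
    change (e ⟨p, e.symmₗ ℝ p _⟩).2 = _
    rw [e.symmₗ_apply hp]
    exact congrArg Prod.snd (e.apply_mk_symm hp _)
  -- At `p₀` neither the constant continuation nor the projection changes `φ₀ (ι v)`, which is
  -- already odd.
  have hfp₀ : f p₀ = φ₀.toAlgHom := by
    refine ExteriorAlgebra.hom_ext (LinearMap.ext fun v => ?_)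
    change f p₀ (ExteriorAlgebra.ι ℝ v) = φ₀ (ExteriorAlgebra.ι ℝ v)
    rw [hfι]
    change GradedAlgebra.proj (𝒜 p₀) 1 (e.symmₗ ℝ p₀ (e.linearMapAt ℝ p₀ _)) = _
    rw [e.symmₗ_linearMapAt hpe]
    exact DirectSum.decompose_of_mem_same _
      ((hφ₀ 1 _).2 (CliffordAlgebra.ι_mem_evenOdd_one _ v))
  have hgr : ∀ p i, ∀ a ∈ grassmannParity n i, f p a ∈ 𝒜 p i := by
    intro p i a ha
    have hpair : ∀ v w, ∀ x ∈ 𝒜 p i,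
        f p (CliffordAlgebra.ι _ v) * f p (CliffordAlgebra.ι _ w) * x ∈ 𝒜 p i := by
      intro v w x hx
      have h1 : ∀ v, f p (CliffordAlgebra.ι _ v) ∈ 𝒜 p 1 := fun v => by
        have := hfι p v
        exact this ▸ hodd p v
      have h2 := SetLike.mul_mem_graded (SetLike.mul_mem_graded (h1 v) (h1 w)) hx
      rwa [show (1 : ZMod 2) + 1 + i = i by rw [show (1 : ZMod 2) + 1 = 0 by decide, zero_add]] at h2
    have hz : ∀ k : ZMod 2, k = 0 ∨ k = 1 := by decide
    rcases hz i with rfl | rfl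
    · induction a, ha using CliffordAlgebra.even_induction with
      | algebraMap r =>
        rw [AlgHom.commutes]
        exact SetLike.algebraMap_mem_graded _ _
      | add x y _ _ hx hy => rw [map_add]; exact add_mem hx hy
      | ι_mul_ι_mul v w x _ hx => rw [map_mul, map_mul]; exact hpair v w _ hx
    · induction a, ha using CliffordAlgebra.odd_induction with
      | ι v => exact (hfι p v).symm ▸ hodd p v
      | add x y _ _ hx hy => rw [map_add]; exact add_mem hx hy
      | ι_mul_ι_mul v w x _ hx => rw [map_mul, map_mul]; exact hpair v w _ hx
  obtain ⟨U, hU, hp₀, hfU⟩ := exists_frame_of_bijective (m := m) (F := F) e.open_baseSet hpe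
    (fun p => (f p).toLinearMap) hsmooth (by
      change Function.Bijective (f p₀)
      rw [hfp₀]
      exact φ₀.bijective)
  -- Away from `U` any graded isomorphism will do; only the values on `U` vary smoothly.
  have hex : ∀ q, ∃ φ : Grassmann n ≃ₐ[ℝ] R q,
      (∀ i a, φ a ∈ 𝒜 q i ↔ a ∈ grassmannParity n i) ∧ (q ∈ U → ∀ a, φ a = f q a) := by
    intro q
    by_cases hq : q ∈ U
    · exact ⟨AlgEquiv.ofBijective (f q) (hfU q hq).1, fun i a =>
        mem_iff_of_graded_of_injective (f q).toLinearMap (hgr q) (hfU q hq).1.1 i a, fun _ _ => rfl⟩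
    · obtain ⟨φ, hφ⟩ := hR.exists_gradedEquiv q
      exact ⟨φ, hφ, fun h => absurd h hq⟩
  choose φ hφ hφf using hex
  refine ⟨U, φ, hU, hp₀, hφ, fun q hq s => ?_⟩
  rw [← (hfU q hq).2]
  refine Filter.EventuallyEq.contMDiffAt_iff ?_
  filter_upwards [hU.mem_nhds hq] with p hp
  have h1 : f p ((φ p).symm (s p)) = s p := by
    rw [← hφf p hp, AlgEquiv.apply_symm_apply]
  exact congrArg (TotalSpace.mk' F p) h1.symm

end SuperFrames

section SuperCharts

variable {m n : ℕ} {M : Type*} [TopologicalSpace M] [ChartedSpace (EuclideanSpace ℝ (Fin m)) M]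
  {F : Type*} [NormedAddCommGroup F] [NormedSpace ℝ F] {R : M → Type*}
  [∀ p, Ring (R p)] [∀ p, Algebra ℝ (R p)]
  [TopologicalSpace (TotalSpace F R)] [∀ p, TopologicalSpace (R p)] [FiberBundle F R]
  [VectorBundle ℝ F R]
  {𝒜 : ∀ p, ZMod 2 → Submodule ℝ (R p)} [IsSmoothAlgebraBundle m F R]

/-! ### Superderivations of the algebra of superfunctions -/

/-- Smooth functions as superfunctions. -/
def ofFunction (f : C^∞⟮𝓡 m, M; ℝ⟯) : Cₛ^∞⟮𝓡 m; F, R⟯ := functionMul f 1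

theorem ofFunction_apply (f : C^∞⟮𝓡 m, M; ℝ⟯) (q : M) :
    (ofFunction f : Cₛ^∞⟮𝓡 m; F, R⟯) q = f q • (1 : R q) := rfl

omit [IsSmoothAlgebraBundle m F R] in
theorem functionMul_apply (f : C^∞⟮𝓡 m, M; ℝ⟯) (s : Cₛ^∞⟮𝓡 m; F, R⟯) (q : M) :
    functionMul f s q = f q • s q := rfl

theorem functionMul_eq_mul (f : C^∞⟮𝓡 m, M; ℝ⟯) (s : Cₛ^∞⟮𝓡 m; F, R⟯) :
    functionMul f s = ofFunction f * s :=
  ContMDiffSection.ext fun q => by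
    rw [section_mul_apply, ofFunction_apply, functionMul_apply, smul_one_mul]

theorem ofFunction_mul (f g : C^∞⟮𝓡 m, M; ℝ⟯) :
    (ofFunction (f * g) : Cₛ^∞⟮𝓡 m; F, R⟯) = functionMul f (ofFunction g) :=
  ContMDiffSection.ext fun q => by
    rw [functionMul_apply, ofFunction_apply, ofFunction_apply, smul_smul]
    rfl

theorem ofFunction_add (f g : C^∞⟮𝓡 m, M; ℝ⟯) :
    (ofFunction (f + g) : Cₛ^∞⟮𝓡 m; F, R⟯) = ofFunction f + ofFunction g :=
  ContMDiffSection.ext fun q => add_smul (f q) (g q) (1 : R q)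

theorem ofFunction_smul (c : ℝ) (f : C^∞⟮𝓡 m, M; ℝ⟯) :
    (ofFunction (c • f) : Cₛ^∞⟮𝓡 m; F, R⟯) = c • ofFunction f :=
  ContMDiffSection.ext fun q => smul_assoc c (f q) (1 : R q)

section Graded

variable [∀ p, GradedAlgebra (𝒜 p)]

theorem ofFunction_mem (f : C^∞⟮𝓡 m, M; ℝ⟯) :
    (ofFunction f : Cₛ^∞⟮𝓡 m; F, R⟯) ∈ sectionParity m F 𝒜 0 := fun _ =>
  Submodule.smul_mem _ _ SetLike.GradedOne.one_mem

/-- The homogeneous components of a superfunction. -/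
def IsSupermanifold.component (hR : IsSupermanifold m n F R 𝒜) (i : ZMod 2)
    (s : Cₛ^∞⟮𝓡 m; F, R⟯) : Cₛ^∞⟮𝓡 m; F, R⟯ :=
  ⟨fun p => GradedRing.proj (𝒜 p) i (s p),
    fun _ => hR.contMDiffAt_component i s _ (s.contMDiff _)⟩

theorem IsSupermanifold.component_mem (hR : IsSupermanifold m n F R 𝒜) (i : ZMod 2)
    (s : Cₛ^∞⟮𝓡 m; F, R⟯) : hR.component i s ∈ sectionParity m F 𝒜 i := fun _ =>
  SetLike.coe_mem _

theorem IsSupermanifold.component_add (hR : IsSupermanifold m n F R 𝒜) (s : Cₛ^∞⟮𝓡 m; F, R⟯) :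
    hR.component 0 s + hR.component 1 s = s :=
  ContMDiffSection.ext fun p => graded_proj_add (𝒜 p) (s p)

theorem IsSupermanifold.exists_homogeneous (hR : IsSupermanifold m n F R 𝒜)
    (s : Cₛ^∞⟮𝓡 m; F, R⟯) : ∃ s₀ ∈ sectionParity m F 𝒜 0, ∃ s₁ ∈ sectionParity m F 𝒜 1,
      s = s₀ + s₁ :=
  ⟨_, hR.component_mem 0 s, _, hR.component_mem 1 s, (hR.component_add s).symm⟩

/-- Superderivations satisfy the Leibniz rule for multiplication by functions. -/
theorem IsSupermanifold.superderivation_functionMul (hR : IsSupermanifold m n F R 𝒜)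
    {D : Cₛ^∞⟮𝓡 m; F, R⟯ →ₗ[ℝ] Cₛ^∞⟮𝓡 m; F, R⟯} (hD : D ∈ SuperVectorField m F 𝒜)
    (f : C^∞⟮𝓡 m, M; ℝ⟯) (s : Cₛ^∞⟮𝓡 m; F, R⟯) :
    D (functionMul f s) = D (ofFunction f) * s + functionMul f (D s) := by
  rw [functionMul_eq_mul, functionMul_eq_mul,
    superderivation_mul_of_even hR.exists_homogeneous hD (ofFunction_mem f) s]

theorem IsSupermanifold.opCommutator_apply (hR : IsSupermanifold m n F R 𝒜)
    {D : Cₛ^∞⟮𝓡 m; F, R⟯ →ₗ[ℝ] Cₛ^∞⟮𝓡 m; F, R⟯} (hD : D ∈ SuperVectorField m F 𝒜)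
    (f : C^∞⟮𝓡 m, M; ℝ⟯) (s : Cₛ^∞⟮𝓡 m; F, R⟯) :
    opCommutator D f s = D (ofFunction f) * s := by
  change D (functionMul f s) - functionMul f (D s) = _
  rw [hR.superderivation_functionMul hD, add_sub_cancel_right]

/-- Superderivations are differential operators of order at most one. -/
theorem IsSupermanifold.isDiffOp_one (hR : IsSupermanifold m n F R 𝒜)
    {D : Cₛ^∞⟮𝓡 m; F, R⟯ →ₗ[ℝ] Cₛ^∞⟮𝓡 m; F, R⟯} (hD : D ∈ SuperVectorField m F 𝒜) :
    IsDiffOp 1 D := by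
  intro f g
  ext s : 1
  change opCommutator D f (functionMul g s) - functionMul g (opCommutator D f s) = 0
  rw [hR.opCommutator_apply hD, hR.opCommutator_apply hD, sub_eq_zero]
  refine ContMDiffSection.ext fun q => ?_
  simp only [section_mul_apply, functionMul_apply, mul_smul_comm]

/-- Superderivations are local. -/
theorem IsSupermanifold.superderivation_congr [T2Space M] [IsManifold (𝓡 m) ∞ M]
    (hR : IsSupermanifold m n F R 𝒜)
    {D : Cₛ^∞⟮𝓡 m; F, R⟯ →ₗ[ℝ] Cₛ^∞⟮𝓡 m; F, R⟯} (hD : D ∈ SuperVectorField m F 𝒜)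
    {s t : Cₛ^∞⟮𝓡 m; F, R⟯} {q : M} (h : ∀ᶠ p in 𝓝 q, s p = t p) : D s q = D t q := by
  have hs : ∀ᶠ p in 𝓝 q, (s - t) p = 0 := h.mono fun p hp => by simp [hp]
  -- With `χ` supported where `s - t` vanishes, `χ (s - t) = 0`; the Leibniz rule at `q` leaves only
  -- `D (s - t)`.
  obtain ⟨χ, W, -, hqW, -, hχ, hsupp⟩ := exists_contMDiffMap_eq_one (m := m) hs
  have h0 : functionMul χ (s - t) = 0 := by
    refine ContMDiffSection.ext fun p => ?_
    rw [functionMul_apply]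
    by_cases hp : (s - t) p = 0
    · rw [hp, smul_zero]; rfl
    · have : χ p = 0 := image_eq_zero_of_notMem_tsupport fun h => hp (hsupp h)
      rw [this, zero_smul]; rfl
  have h1 := hR.superderivation_functionMul hD χ (s - t)
  rw [h0, map_zero] at h1
  have h2 : (0 : R q) = D (ofFunction χ) q * (s - t) q + χ q • D (s - t) q :=
    congrArg (fun s : Cₛ^∞⟮𝓡 m; F, R⟯ => s q) h1
  rw [hs.self_of_nhds, mul_zero, zero_add, hχ q hqW, one_smul, map_sub] at h2
  exact (sub_eq_zero.1 h2.symm)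

end Graded

/-! ### Charts of a supermanifold -/

/-- The derivative of smooth functions along a tangent vector. -/
def vectorDeriv (m : ℕ) {M : Type*} [TopologicalSpace M] [ChartedSpace (EuclideanSpace ℝ (Fin m)) M]
    {q : M} (X : TangentSpace (𝓡 m) q) : C^∞⟮𝓡 m, M; ℝ⟯ →ₗ[ℝ] ℝ where
  toFun f := mvfderiv (𝓡 m) f q X
  map_add' f g := by
    have := mvfderiv_add (I := 𝓡 m) (f.mdifferentiableAt (x := q)) (g.mdifferentiableAt (x := q))
    exact DFunLike.congr_fun this X
  map_smul' c f := by
    have := mvfderiv_mul (I := 𝓡 m) (mdifferentiableAt_const (c := c)) (f.mdifferentiableAt (x := q))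
    rw [mvfderiv_const, smul_zero, add_zero] at this
    exact DFunLike.congr_fun this X

theorem vectorDeriv_apply {q : M} (X : TangentSpace (𝓡 m) q) (f : C^∞⟮𝓡 m, M; ℝ⟯) :
    vectorDeriv m X f = mvfderiv (𝓡 m) f q X := rfl

theorem vectorDeriv_mul {q : M} (X : TangentSpace (𝓡 m) q) (f g : C^∞⟮𝓡 m, M; ℝ⟯) :
    vectorDeriv m X (f * g) = f q * vectorDeriv m X g + g q * vectorDeriv m X f :=
  DFunLike.congr_fun (mvfderiv_mul (I := 𝓡 m) (f.mdifferentiableAt (x := q))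
    (g.mdifferentiableAt (x := q))) X

theorem vectorDeriv_congr {q : M} (X : TangentSpace (𝓡 m) q) {f g : C^∞⟮𝓡 m, M; ℝ⟯}
    (h : ∀ᶠ p in 𝓝 q, f p = g p) : vectorDeriv m X f = vectorDeriv m X g := by
  rw [vectorDeriv_apply, vectorDeriv_apply, mvfderiv_congr h]

theorem vectorDeriv_eq_zero {q : M} (X : TangentSpace (𝓡 m) q) {f : C^∞⟮𝓡 m, M; ℝ⟯} {c : ℝ}
    (h : ∀ᶠ p in 𝓝 q, f p = c) : vectorDeriv m X f = 0 := by
  have : mvfderiv (𝓡 m) f q = mvfderiv (𝓡 m) (fun _ => c) q := mvfderiv_congr h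
  rw [vectorDeriv_apply, this, mvfderiv_const]
  rfl

variable (m n F R 𝒜) in
/-- A chart of a supermanifold: an open set with even and odd coordinates, given by a
trivialization of the bundle of superalgebras and by coordinate functions with their coordinate
vector fields. The coordinates of superfunctions and the constant superfunctions are extended to
all of `M`. -/
structure SuperChart [IsManifold (𝓡 m) ∞ M] where
  U : Set M
  isOpen : IsOpen U
  φ : ∀ q, Grassmann n ≃ₐ[ℝ] R q
  graded : ∀ q i a, φ q a ∈ 𝒜 q i ↔ a ∈ grassmannParity n i
  smooth_iff : ∀ q ∈ U, ∀ s : ∀ p, R p, SmoothSectionAt m F s q ↔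
    WeaklySmoothAt m (fun p => (φ p).symm (s p)) q
  const : Grassmann n →ₗ[ℝ] Cₛ^∞⟮𝓡 m; F, R⟯
  const_apply : ∀ q ∈ U, ∀ a, const a q = φ q a
  const_mem : ∀ i, ∀ a ∈ grassmannParity n i, const a ∈ sectionParity m F 𝒜 i
  coef : (Grassmann n →ₗ[ℝ] ℝ) →ₗ[ℝ] Cₛ^∞⟮𝓡 m; F, R⟯ →ₗ[ℝ] C^∞⟮𝓡 m, M; ℝ⟯
  coef_apply : ∀ q ∈ U, ∀ l s, coef l s q = l ((φ q).symm (s q))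
  x : Fin m → C^∞⟮𝓡 m, M; ℝ⟯
  X : Fin m → ∀ p : M, TangentSpace (𝓡 m) p
  contMDiff_X : ∀ j, ContMDiff (𝓡 m) ((𝓡 m).prod 𝓘(ℝ, EuclideanSpace ℝ (Fin m))) ∞
    (fun p => TotalSpace.mk' (EuclideanSpace ℝ (Fin m)) p (X j p))
  dx_X : ∀ q ∈ U, ∀ i j, mvfderiv (𝓡 m) (x i) q (X j q) = if i = j then 1 else 0

/-- One cut-off function serves the frame and the coordinates. The chart domain shrinks to the set
where it equals one, so the extended constants and coefficients are globally smooth and correct on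
the domain. -/
theorem IsSupermanifold.exists_superChart [T2Space M] [IsManifold (𝓡 m) ∞ M]
    [FiniteDimensional ℝ F] [ContMDiffVectorBundle ∞ F R (𝓡 m)] [∀ p, GradedAlgebra (𝒜 p)]
    (hR : IsSupermanifold m n F R 𝒜) (p₀ : M) : ∃ c : SuperChart m n F R 𝒜, p₀ ∈ c.U := by
  obtain ⟨U₁, φ, hU₁, hp₁, hgr, hsm⟩ := exists_superFrame hR p₀
  obtain ⟨U₂, x, X, hU₂, hp₂, hdx⟩ := exists_localCoordinates (m := m) p₀
  obtain ⟨χ, W, hW, hpW, hWU, hχ, hsupp⟩ := exists_contMDiffMap_eq_one (m := m)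
    ((hU₁.inter hU₂).mem_nhds ⟨hp₁, hp₂⟩)
  have hconst : ∀ a : Grassmann n, ContMDiff (𝓡 m) ((𝓡 m).prod 𝓘(ℝ, F)) ∞
      (fun p => TotalSpace.mk' F p (χ p • φ p a)) := by
    intro a
    refine ContMDiffOn.smul_section_of_tsupport (u := U₁ ∩ U₂) χ.contMDiff.contMDiffOn
      (hU₁.inter hU₂) hsupp fun p hp => ContMDiffAt.contMDiffWithinAt ?_
    refine (hsm p hp.1 _).2 ?_
    simp only [AlgEquiv.symm_apply_apply]
    exact WeaklySmoothAt.const a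
  have hcoef : ∀ (l : Grassmann n →ₗ[ℝ] ℝ) (s : Cₛ^∞⟮𝓡 m; F, R⟯),
      ContMDiff (𝓡 m) 𝓘(ℝ, ℝ) ∞ (fun p => χ p * l ((φ p).symm (s p))) := by
    intro l s
    refine contMDiff_of_tsupport fun p hp => χ.contMDiff.contMDiffAt.mul ?_
    exact (hsm p (hsupp (tsupport_mul_subset_left hp)).1 s).1 (s.contMDiff p) l
  refine ⟨{ U := W, isOpen := hW, φ := φ, graded := hgr
            smooth_iff := fun q hq => hsm q (hWU hq).1
            const :=
              { toFun := fun a => ⟨_, hconst a⟩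
                map_add' := fun a b => ContMDiffSection.ext fun p => by
                  change χ p • φ p (a + b) = χ p • φ p a + χ p • φ p b
                  rw [map_add, smul_add]
                map_smul' := fun r a => ContMDiffSection.ext fun p => by
                  change χ p • φ p (r • a) = r • (χ p • φ p a)
                  rw [map_smul, smul_comm] }
            const_apply := fun q hq a => by
              change χ q • φ q a = φ q a
              rw [hχ q hq, one_smul]
            const_mem := fun i a ha p => Submodule.smul_mem _ _ ((hgr p i a).2 ha)
            coef := LinearMap.mk₂ ℝ (fun l s => ⟨_, hcoef l s⟩)
              (fun l l' s => by ext p; exact mul_add _ _ _)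
              (fun r l s => by ext p; exact mul_left_comm _ _ _)
              (fun l s t => by
                ext p
                change χ p * l ((φ p).symm (s p + t p))
                  = χ p * l ((φ p).symm (s p)) + χ p * l ((φ p).symm (t p))
                rw [map_add, map_add, mul_add])
              (fun r l s => by
                ext p
                change χ p * l ((φ p).symm (r • s p)) = r * (χ p * l ((φ p).symm (s p)))
                rw [map_smul, map_smul, smul_eq_mul, mul_left_comm])
            coef_apply := fun q hq l s => by
              change χ q * l ((φ q).symm (s q)) = _
              rw [hχ q hq, one_mul]
            x := x, X := fun j => X j
            contMDiff_X := fun j => (X j).contMDiff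
            dx_X := fun q hq => hdx q (hWU hq).2 }, hpW⟩

end SuperCharts

/-! ### First-order operators in a chart and their symbols -/

section SuperChartOperators

variable {m n : ℕ} {M : Type*} [TopologicalSpace M] [ChartedSpace (EuclideanSpace ℝ (Fin m)) M]
  [IsManifold (𝓡 m) ∞ M]
  {F : Type*} [NormedAddCommGroup F] [NormedSpace ℝ F] {R : M → Type*}
  [∀ p, Ring (R p)] [∀ p, Algebra ℝ (R p)]
  [TopologicalSpace (TotalSpace F R)] [∀ p, TopologicalSpace (R p)] [FiberBundle F R]
  [VectorBundle ℝ F R]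
  {𝒜 : ∀ p, ZMod 2 → Submodule ℝ (R p)} [IsSmoothAlgebraBundle m F R]

/-- The pairs of a linear endomorphism of the Grassmann algebra and coefficients of a vector field,
which describe operators on superfunctions at a point. -/
abbrev OperatorSymbol (m n : ℕ) : Type :=
  (Grassmann n →ₗ[ℝ] Grassmann n) × (Fin m → Grassmann n)

namespace SuperChart

variable (c : SuperChart m n F R 𝒜)

/-- The derivative of a superfunction along a coordinate vector field, in a trivialization. -/
def deriv (j : Fin m) (q : M) : Cₛ^∞⟮𝓡 m; F, R⟯ →ₗ[ℝ] Grassmann n :=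
  ∑ i, LinearMap.toSpanSingleton ℝ _ (Module.finBasis ℝ (Grassmann n) i) ∘ₗ
    vectorDeriv m (c.X j q) ∘ₗ c.coef ((Module.finBasis ℝ (Grassmann n)).coord i)

theorem deriv_eq_sum (j : Fin m) (q : M) (s : Cₛ^∞⟮𝓡 m; F, R⟯) :
    c.deriv j q s = ∑ i, vectorDeriv m (c.X j q)
      (c.coef ((Module.finBasis ℝ (Grassmann n)).coord i) s) •
        Module.finBasis ℝ (Grassmann n) i := by
  simp [deriv]

/-- Linearity of `coef` in the functional frees `deriv` from its basis, so identities can be checked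
one functional at a time. -/
theorem apply_deriv (l : Grassmann n →ₗ[ℝ] ℝ) (j : Fin m) (q : M) (s : Cₛ^∞⟮𝓡 m; F, R⟯) :
    l (c.deriv j q s) = vectorDeriv m (c.X j q) (c.coef l s) := by
  let b := Module.finBasis ℝ (Grassmann n)
  have hl : l = ∑ i, l (b i) • b.coord i := by
    refine b.ext fun k => ?_
    simp
  have h2 : c.coef l s = ∑ i, l (b i) • c.coef (b.coord i) s := by
    have := congrArg (fun l => c.coef l s) hl
    simpa only [map_sum, map_smul, LinearMap.sum_apply, LinearMap.smul_apply] using this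
  rw [h2, deriv_eq_sum, map_sum, map_sum]
  refine Finset.sum_congr rfl fun i _ => ?_
  rw [map_smul, map_smul, smul_eq_mul, smul_eq_mul, mul_comm]

theorem ext_functional {a b : Grassmann n} (h : ∀ l : Grassmann n →ₗ[ℝ] ℝ, l a = l b) : a = b := by
  rw [← sub_eq_zero, ← Module.forall_dual_apply_eq_zero_iff ℝ]
  intro l
  rw [map_sub, h l, sub_self]

variable {c} {q : M}

theorem eventually_coef (hq : q ∈ c.U) (l : Grassmann n →ₗ[ℝ] ℝ) (s : Cₛ^∞⟮𝓡 m; F, R⟯) :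
    ∀ᶠ p in 𝓝 q, c.coef l s p = l ((c.φ p).symm (s p)) := by
  filter_upwards [c.isOpen.mem_nhds hq] with p hp using c.coef_apply p hp l s

theorem deriv_mul (hq : q ∈ c.U) (j : Fin m) (s t : Cₛ^∞⟮𝓡 m; F, R⟯) :
    c.deriv j q (s * t) = c.deriv j q s * (c.φ q).symm (t q) +
      (c.φ q).symm (s q) * c.deriv j q t := by
  let b := Module.finBasis ℝ (Grassmann n)
  have hexp : ∀ a : Grassmann n, a = ∑ i, b.coord i a • b i := fun a => by
    conv_lhs => rw [← b.sum_repr a]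
    rfl
  refine ext_functional fun l => ?_
  -- The structure constants of the Grassmann algebra do not depend on the point, because the frame
  -- is multiplicative. This reduces the claim to the product rule for scalar functions.
  have h1 : ∀ᶠ p in 𝓝 q, c.coef l (s * t) p
      = (∑ i, ∑ k, l (b i * b k) • (c.coef (b.coord i) s * c.coef (b.coord k) t)) p := by
    filter_upwards [c.isOpen.mem_nhds hq] with p hp
    have hsum : (∑ i, ∑ k, l (b i * b k) • (c.coef (b.coord i) s * c.coef (b.coord k) t)) p
        = ∑ i, ∑ k, l (b i * b k) * (c.coef (b.coord i) s p * c.coef (b.coord k) t p) := by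
      rw [← ContMDiffMap.coeFnRingHom_apply, map_sum, Finset.sum_apply]
      refine Finset.sum_congr rfl fun i _ => ?_
      rw [map_sum, Finset.sum_apply]
      rfl
    rw [hsum, c.coef_apply p hp, section_mul_apply, map_mul]
    conv_lhs => rw [hexp ((c.φ p).symm (s p)), hexp ((c.φ p).symm (t p)), Finset.sum_mul_sum]
    simp only [map_sum, smul_mul_smul_comm, map_smul, smul_eq_mul]
    refine Finset.sum_congr rfl fun i _ => Finset.sum_congr rfl fun k _ => ?_
    rw [c.coef_apply p hp, c.coef_apply p hp, mul_comm]
  have h3 : (c.φ q).symm (t q) = ∑ k, c.coef (b.coord k) t q • b k := by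
    conv_lhs => rw [hexp ((c.φ q).symm (t q))]
    simp only [c.coef_apply q hq]
  have h4 : (c.φ q).symm (s q) = ∑ i, c.coef (b.coord i) s q • b i := by
    conv_lhs => rw [hexp ((c.φ q).symm (s q))]
    simp only [c.coef_apply q hq]
  rw [apply_deriv, vectorDeriv_congr _ h1, deriv_eq_sum, deriv_eq_sum, h3, h4, map_add,
    Finset.sum_mul_sum, Finset.sum_mul_sum]
  simp only [map_sum, map_smul, vectorDeriv_mul, smul_mul_smul_comm, smul_eq_mul]
  rw [← Finset.sum_add_distrib]
  refine Finset.sum_congr rfl fun i _ => ?_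
  rw [← Finset.sum_add_distrib]
  exact Finset.sum_congr rfl fun k _ => by ring

/-- A functional annihilating the parity subspace has a coefficient function vanishing near `q`,
hence zero derivative; such functionals cut out the subspace. -/
theorem deriv_mem (hq : q ∈ c.U) (j : Fin m) {i : ZMod 2} {s : Cₛ^∞⟮𝓡 m; F, R⟯}
    (hs : s ∈ sectionParity m F 𝒜 i) : c.deriv j q s ∈ grassmannParity n i := by
  rw [← Subspace.forall_mem_dualAnnihilator_apply_eq_zero_iff]
  intro l hl
  rw [Submodule.mem_dualAnnihilator] at hl
  rw [apply_deriv]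
  refine vectorDeriv_eq_zero (c := 0) _ ?_
  filter_upwards [eventually_coef hq l s] with p hp
  rw [hp]
  refine hl _ ((c.graded p i _).1 ?_)
  rw [AlgEquiv.apply_symm_apply]
  exact hs p

theorem deriv_const (hq : q ∈ c.U) (j : Fin m) (a : Grassmann n) :
    c.deriv j q (c.const a) = 0 := by
  refine ext_functional fun l => ?_
  rw [apply_deriv, map_zero]
  refine vectorDeriv_eq_zero (c := l a) _ ?_
  filter_upwards [c.isOpen.mem_nhds hq] with p hp
  rw [c.coef_apply p hp, c.const_apply p hp, AlgEquiv.symm_apply_apply]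

theorem deriv_ofFunction (hq : q ∈ c.U) (j : Fin m) (f : C^∞⟮𝓡 m, M; ℝ⟯) :
    c.deriv j q (ofFunction f) = vectorDeriv m (c.X j q) f • (1 : Grassmann n) := by
  refine ext_functional fun l => ?_
  have h : ∀ᶠ p in 𝓝 q, c.coef l (ofFunction f) p = (l 1 • f) p := by
    filter_upwards [c.isOpen.mem_nhds hq] with p hp
    rw [c.coef_apply p hp, ofFunction_apply, map_smul, map_one, map_smul, smul_eq_mul, mul_comm]
    rfl
  rw [apply_deriv, vectorDeriv_congr _ h, map_smul, map_smul, smul_eq_mul, smul_eq_mul, mul_comm]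

theorem deriv_x (hq : q ∈ c.U) (i j : Fin m) :
    c.deriv j q (ofFunction (c.x i)) = if i = j then 1 else 0 := by
  rw [deriv_ofFunction hq, vectorDeriv_apply, c.dx_X q hq]
  split_ifs <;> simp

variable (c q) in
/-- The operator at a point with given symbol. -/
def op : OperatorSymbol m n →ₗ[ℝ] Cₛ^∞⟮𝓡 m; F, R⟯ →ₗ[ℝ] R q :=
  LinearMap.mk₂ ℝ (fun e s => c.φ q (e.1 ((c.φ q).symm (s q)) + ∑ j, e.2 j * c.deriv j q s))
    (fun e e' s => by
      rw [← map_add]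
      simp only [Prod.fst_add, Prod.snd_add, LinearMap.add_apply, Pi.add_apply, add_mul,
        Finset.sum_add_distrib]
      congr 1
      abel)
    (fun r e s => by
      rw [← map_smul]
      simp [smul_add, Finset.smul_sum])
    (fun e s t => by
      rw [← map_add]
      simp only [ContMDiffSection.coe_add, Pi.add_apply, map_add, mul_add, Finset.sum_add_distrib]
      abel)
    (fun r e s => by
      rw [← map_smul]
      simp [smul_add, Finset.smul_sum])

theorem op_apply (e : OperatorSymbol m n) (s : Cₛ^∞⟮𝓡 m; F, R⟯) :
    c.op q e s = c.φ q (e.1 ((c.φ q).symm (s q)) + ∑ j, e.2 j * c.deriv j q s) := rfl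

theorem op_const (hq : q ∈ c.U) (e : OperatorSymbol m n) (a : Grassmann n) :
    c.op q e (c.const a) = c.φ q (e.1 a) := by
  simp [op_apply, deriv_const hq, c.const_apply q hq]

theorem op_ofFunction (hq : q ∈ c.U) (e : OperatorSymbol m n) (f : C^∞⟮𝓡 m, M; ℝ⟯) :
    c.op q e (ofFunction f)
      = c.φ q (f q • e.1 1 + ∑ j, vectorDeriv m (c.X j q) f • e.2 j) := by
  simp [op_apply, deriv_ofFunction hq, ofFunction_apply]

theorem op_x (hq : q ∈ c.U) (e : OperatorSymbol m n) (j : Fin m) :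
    c.op q e (ofFunction (c.x j)) = c.φ q (c.x j q • e.1 1 + e.2 j) := by
  simp [op_apply, deriv_x hq, ofFunction_apply]

/-- Constants detect the endomorphism, and the coordinate functions then detect the vector field
coefficients. -/
theorem op_injective (hq : q ∈ c.U) : Function.Injective (c.op q) := by
  rw [injective_iff_map_eq_zero]
  intro e he
  have h1 : ∀ a, e.1 a = 0 := fun a => by
    have := op_const hq e a
    rw [he, LinearMap.zero_apply] at this
    exact (map_eq_zero_iff _ (c.φ q).injective).1 this.symm
  have h2 : ∀ j, e.2 j = 0 := fun j => by
    have := op_x hq e j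
    rw [he, LinearMap.zero_apply, h1, smul_zero, zero_add] at this
    exact (map_eq_zero_iff _ (c.φ q).injective).1 this.symm
  exact Prod.ext (LinearMap.ext h1) (funext h2)

theorem contMDiff_vectorDeriv (j : Fin m) (f : C^∞⟮𝓡 m, M; ℝ⟯) :
    ContMDiff (𝓡 m) 𝓘(ℝ, ℝ) ∞ (fun p => vectorDeriv m (c.X j p) f) := fun p =>
  contMDiffAt_mvfderiv_apply (f.contMDiff p) (c.contMDiff_X j p)

theorem weaklySmoothAt_deriv (j : Fin m) (s : Cₛ^∞⟮𝓡 m; F, R⟯) :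
    WeaklySmoothAt m (fun p => c.deriv j p s) q := fun l => by
  simp only [apply_deriv]
  exact contMDiff_vectorDeriv j _ q

theorem smoothSectionAt_op (hq : q ∈ c.U) {e : M → OperatorSymbol m n} (he : WeaklySmoothAt m e q)
    (s : Cₛ^∞⟮𝓡 m; F, R⟯) : SmoothSectionAt m F (fun p => c.op p (e p) s) q := by
  rw [c.smooth_iff q hq]
  simp only [op_apply, AlgEquiv.symm_apply_apply]
  refine WeaklySmoothAt.add ?_ (WeaklySmoothAt.sum fun j _ => ?_)
  · exact WeaklySmoothAt.bilinear LinearMap.id (he.linearMap (LinearMap.fst ℝ _ _))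
      ((c.smooth_iff q hq _).1 (s.contMDiff q))
  · exact WeaklySmoothAt.bilinear (LinearMap.mul ℝ (Grassmann n))
      (he.linearMap (LinearMap.proj j ∘ₗ LinearMap.snd ℝ _ _)) (weaklySmoothAt_deriv j s)

theorem weaklySmoothAt_of_op (hq : q ∈ c.U) {e : M → OperatorSymbol m n}
    (he : ∀ s, SmoothSectionAt m F (fun p => c.op p (e p) s) q) : WeaklySmoothAt m e q := by
  have h1 : ∀ a, WeaklySmoothAt m (fun p => (e p).1 a) q := fun a => by
    refine ((c.smooth_iff q hq _).1 (he (c.const a))).congr ?_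
    filter_upwards [c.isOpen.mem_nhds hq] with p hp
    rw [op_const hp, AlgEquiv.symm_apply_apply]
  refine WeaklySmoothAt.prodMk (WeaklySmoothAt.hom h1) (WeaklySmoothAt.pi fun j => ?_)
  -- The operator sends `x_j` to `x_j • e.1 1 + e.2 j`; subtracting the first term, already known to
  -- be smooth, isolates the coefficient.
  have h2 := ((c.smooth_iff q hq _).1 (he (ofFunction (c.x j)))).add
    (((h1 1).smul ((c.x j).contMDiff q)).linearMap (-LinearMap.id))
  refine h2.congr ?_
  filter_upwards [c.isOpen.mem_nhds hq] with p hp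
  rw [op_x hp, AlgEquiv.symm_apply_apply]
  simp

/-- The symbols of superderivations of given parity. -/
def HasParity (k : ZMod 2) (e : OperatorSymbol m n) : Prop :=
  e.1 ∈ superderivationsOfParity (grassmannParity n) k ∧ ∀ j, e.2 j ∈ grassmannParity n k

theorem op_mem {k i : ZMod 2} {e : OperatorSymbol m n} (he : HasParity k e) (hq : q ∈ c.U)
    {s : Cₛ^∞⟮𝓡 m; F, R⟯} (hs : s ∈ sectionParity m F 𝒜 i) : c.op q e s ∈ 𝒜 q (i + k) := by
  rw [op_apply, c.graded]
  refine add_mem (he.1.1 i _ ?_) (Submodule.sum_mem _ fun j _ => ?_)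
  · rw [← c.graded q, AlgEquiv.apply_symm_apply]
    exact hs q
  · rw [add_comm]
    exact SetLike.mul_mem_graded (he.2 j) (deriv_mem hq j hs)

theorem op_mul {k i i' : ZMod 2} {e : OperatorSymbol m n} (he : HasParity k e) (hq : q ∈ c.U)
    {s t : Cₛ^∞⟮𝓡 m; F, R⟯} (hs : s ∈ sectionParity m F 𝒜 i) (ht : t ∈ sectionParity m F 𝒜 i') :
    c.op q e (s * t) = c.op q e s * t q + (-1 : ℝ) ^ (i * k).val • (s q * c.op q e t) := by
  have hs' : (c.φ q).symm (s q) ∈ grassmannParity n i := by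
    rw [← c.graded q, AlgEquiv.apply_symm_apply]; exact hs q
  have ht' : (c.φ q).symm (t q) ∈ grassmannParity n i' := by
    rw [← c.graded q, AlgEquiv.apply_symm_apply]; exact ht q
  apply (c.φ q).symm.injective
  simp only [op_apply, map_add, map_mul, map_smul, AlgEquiv.symm_apply_apply]
  rw [section_mul_apply, map_mul, he.1.2 i i' _ hs' _ ht']
  -- The Koszul sign comes from moving `e.2 j`, of parity `k`, past `s`; the derivative along a
  -- field on the base is even and contributes none.
  have hj : ∀ j, e.2 j * c.deriv j q (s * t) = e.2 j * c.deriv j q s * (c.φ q).symm (t q) +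
      (-1 : ℝ) ^ (i * k).val • ((c.φ q).symm (s q) * (e.2 j * c.deriv j q t)) := fun j => by
    rw [deriv_mul hq, mul_add, ← mul_assoc, ← mul_assoc, ← mul_assoc,
      exteriorAlgebra_supercomm (he.2 j) hs', smul_mul_assoc, mul_comm k i]
  simp only [hj, Finset.sum_add_distrib, add_mul, mul_add, smul_add, Finset.sum_mul,
    Finset.mul_sum, Finset.smul_sum]
  abel

end SuperChart

end SuperChartOperators

/-! ### Values of superderivations in a chart -/

section SuperChartValues

variable {m n : ℕ} {M : Type*} [TopologicalSpace M] [ChartedSpace (EuclideanSpace ℝ (Fin m)) M]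
  [IsManifold (𝓡 m) ∞ M]
  {F : Type*} [NormedAddCommGroup F] [NormedSpace ℝ F] {R : M → Type*}
  [∀ p, Ring (R p)] [∀ p, Algebra ℝ (R p)]
  [TopologicalSpace (TotalSpace F R)] [∀ p, TopologicalSpace (R p)] [FiberBundle F R]
  [VectorBundle ℝ F R]
  {𝒜 : ∀ p, ZMod 2 → Submodule ℝ (R p)} [IsSmoothAlgebraBundle m F R]

namespace SuperChart

variable {c : SuperChart m n F R 𝒜} {q : M}

/-- The symbol is kept constant over the chart and the operator is multiplied by a cut-off function.
That function is even, so the parity and the Leibniz rule survive, and it is one at `q`. -/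
theorem op_mem_derFibre_of_hasParity [T2Space M] {k : ZMod 2} {e : OperatorSymbol m n}
    (he : HasParity k e) (hq : q ∈ c.U) : c.op q e ∈ derFibre m F 𝒜 q := by
  obtain ⟨χ, W, -, hqW, -, hχ, hsupp⟩ :=
    exists_contMDiffMap_eq_one (m := m) (c.isOpen.mem_nhds hq)
  have hsm : ∀ s, ContMDiff (𝓡 m) ((𝓡 m).prod 𝓘(ℝ, F)) ∞
      (fun p => TotalSpace.mk' F p (χ p • c.op p e s)) := fun s =>
    ContMDiffOn.smul_section_of_tsupport χ.contMDiff.contMDiffOn c.isOpen hsupp fun p hp =>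
      ContMDiffAt.contMDiffWithinAt (smoothSectionAt_op hp (WeaklySmoothAt.const e) s)
  let D : Cₛ^∞⟮𝓡 m; F, R⟯ →ₗ[ℝ] Cₛ^∞⟮𝓡 m; F, R⟯ :=
    { toFun := fun s => ⟨_, hsm s⟩
      map_add' := fun s t => ContMDiffSection.ext fun p => by
        change χ p • c.op p e (s + t) = χ p • c.op p e s + χ p • c.op p e t
        rw [map_add, smul_add]
      map_smul' := fun r s => ContMDiffSection.ext fun p => by
        change χ p • c.op p e (r • s) = r • (χ p • c.op p e s)
        rw [map_smul, smul_comm] }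
  have hD : D ∈ superderivationsOfParity (sectionParity m F 𝒜) k := by
    have hzero : ∀ p ∉ c.U, χ p = 0 := fun p hp =>
      image_eq_zero_of_notMem_tsupport fun h => hp (hsupp h)
    refine ⟨fun i s hs p => ?_, fun i j s hs t ht => ContMDiffSection.ext fun p => ?_⟩
    · change χ p • c.op p e s ∈ _
      by_cases hp : p ∈ c.U
      · exact Submodule.smul_mem _ _ (op_mem he hp hs)
      · rw [hzero p hp, zero_smul]
        exact zero_mem _
    · change χ p • c.op p e (s * t)
        = χ p • c.op p e s * t p + (-1 : ℝ) ^ (i * k).val • (s p * χ p • c.op p e t)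
      by_cases hp : p ∈ c.U
      · rw [op_mul he hp hs ht, smul_add, smul_mul_assoc, mul_smul_comm, smul_comm (χ p)]
      · simp [hzero p hp]
  refine ⟨⟨D, superderivationsOfParity_le_sder _ k hD⟩, LinearMap.ext fun s => ?_⟩
  change χ q • c.op q e s = _
  rw [hχ q hqW, one_smul]

theorem op_mem_derFibre [T2Space M] {e : OperatorSymbol m n} (he : e.1 ∈ sder (grassmannParity n))
    (hq : q ∈ c.U) : c.op q e ∈ derFibre m F 𝒜 q := by
  obtain ⟨A, hA, hsum⟩ := exists_parity_of_mem_sder he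
  let e' : ZMod 2 → OperatorSymbol m n := fun k =>
    (A k, fun j => GradedRing.proj (grassmannParity n) k (e.2 j))
  have he' : ∀ k, HasParity k (e' k) := fun k => ⟨hA k, fun j => SetLike.coe_mem _⟩
  have : e = e' 0 + e' 1 :=
    Prod.ext hsum (funext fun j => (graded_proj_add (grassmannParity n) (e.2 j)).symm)
  rw [this, map_add]
  exact add_mem (op_mem_derFibre_of_hasParity (he' 0) hq) (op_mem_derFibre_of_hasParity (he' 1) hq)

variable (c) in
/-- The coordinate vector fields form a basis of the tangent space. -/
theorem exists_basis (hq : q ∈ c.U) :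
    ∃ b : Module.Basis (Fin m) ℝ (TangentSpace (𝓡 m) q), ∀ j, b j = c.X j q := by
  have hli : LinearIndependent ℝ fun j => c.X j q := by
    rw [Fintype.linearIndependent_iff]
    intro g hg i
    have h := congrArg (mvfderiv (𝓡 m) (c.x i) q) hg
    rw [map_sum, map_zero] at h
    simpa [c.dx_X q hq] using h
  have hcard : Fintype.card (Fin m) = Module.finrank ℝ (TangentSpace (𝓡 m) q) := by
    have : Module.finrank ℝ (TangentSpace (𝓡 m) q)
        = Module.finrank ℝ (EuclideanSpace ℝ (Fin m)) := rfl
    rw [this, finrank_euclideanSpace]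
  -- The construction of a basis from the dimension count needs a nonempty index, so dimension zero
  -- is separate.
  rcases isEmpty_or_nonempty (Fin m) with hm | hm
  · have : Subsingleton (TangentSpace (𝓡 m) q) :=
      inferInstanceAs (Subsingleton (EuclideanSpace ℝ (Fin m)))
    exact ⟨Module.Basis.empty _, fun j => isEmptyElim j⟩
  · exact ⟨basisOfLinearIndependentOfCardEqFinrank hli hcard, fun j => by simp⟩

theorem vectorDeriv_x (hq : q ∈ c.U) (i j : Fin m) :
    vectorDeriv m (c.X j q) (c.x i) = if i = j then 1 else 0 := c.dx_X q hq i j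

/-- Point derivations are combinations of the coordinate vector fields. -/
theorem pointDerivation_eq_sum [T2Space M] (hq : q ∈ c.U) {v : C^∞⟮𝓡 m, M; ℝ⟯ →ₗ[ℝ] ℝ}
    (hv : ∀ f g, v (f * g) = f q * v g + g q * v f) (f : C^∞⟮𝓡 m, M; ℝ⟯) :
    v f = ∑ j, vectorDeriv m (c.X j q) f * v (c.x j) := by
  obtain ⟨b, hb⟩ := c.exists_basis hq
  -- Subtracting the first-order part of `f` leaves a function with zero differential at `q`, which
  -- every point derivation kills.
  have h : mvfderiv (𝓡 m) (f - ∑ j, vectorDeriv m (c.X j q) f • c.x j : C^∞⟮𝓡 m, M; ℝ⟯) q = 0 := by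
    refine ContinuousLinearMap.coe_injective (b.ext fun i => ?_)
    rw [hb]
    change vectorDeriv m (c.X i q) (f - ∑ j, vectorDeriv m (c.X j q) f • c.x j) = 0
    simp [vectorDeriv_x hq]
  have h0 := pointDerivation_eq_zero hv h
  rw [map_sub, sub_eq_zero, map_sum] at h0
  simpa using h0

section Graded

variable [∀ p, GradedAlgebra (𝒜 p)] [T2Space M]

/-- Composed with a functional on the fibre, `f ↦ D(f)(q)` is an ordinary point derivation, hence a
combination of the coordinate fields. -/
theorem superderivation_ofFunction (hR : IsSupermanifold m n F R 𝒜) (hq : q ∈ c.U)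
    {D : Cₛ^∞⟮𝓡 m; F, R⟯ →ₗ[ℝ] Cₛ^∞⟮𝓡 m; F, R⟯} (hD : D ∈ SuperVectorField m F 𝒜)
    (f : C^∞⟮𝓡 m, M; ℝ⟯) : D (ofFunction f) q
      = ∑ j, vectorDeriv m (c.X j q) f • D (ofFunction (c.x j)) q := by
  refine (c.φ q).symm.injective (ext_functional fun l => ?_)
  let v : C^∞⟮𝓡 m, M; ℝ⟯ →ₗ[ℝ] ℝ :=
    { toFun := fun f => l ((c.φ q).symm (D (ofFunction f) q))
      map_add' := fun f g => by
        rw [ofFunction_add, map_add, ContMDiffSection.coe_add, Pi.add_apply, map_add, map_add]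
      map_smul' := fun r f => by
        rw [ofFunction_smul, map_smul, ContMDiffSection.coe_smul, Pi.smul_apply, map_smul, map_smul]
        rfl }
  have hv : ∀ f g, v (f * g) = f q * v g + g q * v f := fun f g => by
    change l ((c.φ q).symm (D (ofFunction (f * g)) q)) = f q * l ((c.φ q).symm (D (ofFunction g) q))
      + g q * l ((c.φ q).symm (D (ofFunction f) q))
    rw [ofFunction_mul, hR.superderivation_functionMul hD, ContMDiffSection.coe_add, Pi.add_apply,
      section_mul_apply, functionMul_apply, ofFunction_apply, mul_smul_comm, mul_one]
    simp only [map_add, map_smul, smul_eq_mul]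
    ring
  have h := pointDerivation_eq_sum hq hv f
  simp only [map_sum, map_smul, smul_eq_mul]
  exact h

variable (c q) in
/-- The endomorphism of the Grassmann algebra by which an operator acts on constants. -/
def onConst (D : Cₛ^∞⟮𝓡 m; F, R⟯ →ₗ[ℝ] Cₛ^∞⟮𝓡 m; F, R⟯) : Grassmann n →ₗ[ℝ] Grassmann n where
  toFun a := (c.φ q).symm (D (c.const a) q)
  map_add' a b := by simp
  map_smul' r a := by simp

theorem onConst_mem (hR : IsSupermanifold m n F R 𝒜) (hq : q ∈ c.U)
    {D : Cₛ^∞⟮𝓡 m; F, R⟯ →ₗ[ℝ] Cₛ^∞⟮𝓡 m; F, R⟯} (hD : D ∈ SuperVectorField m F 𝒜) :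
    c.onConst q D ∈ sder (grassmannParity n) := by
  refine mem_sder_induction (p := fun D => c.onConst q D ∈ sder (grassmannParity n))
    (fun k D hD => superderivationsOfParity_le_sder _ k ⟨fun i a ha => ?_, fun i j a ha b hb => ?_⟩)
    (fun D D' h h' => ?_) hD
  · rw [← c.graded q]
    change c.φ q ((c.φ q).symm (D (c.const a) q)) ∈ _
    rw [AlgEquiv.apply_symm_apply]
    exact hD.1 i _ (c.const_mem i a ha) q
  · change (c.φ q).symm (D (c.const (a * b)) q) = (c.φ q).symm (D (c.const a) q) * b +
      (-1 : ℝ) ^ (i * k).val • (a * (c.φ q).symm (D (c.const b) q))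
    -- Extended constants multiply correctly only on the chart domain, so locality of `D` is needed.
    have h1 : D (c.const (a * b)) q = D (c.const a * c.const b) q := by
      refine hR.superderivation_congr (superderivationsOfParity_le_sder _ k hD) ?_
      filter_upwards [c.isOpen.mem_nhds hq] with p hp
      rw [section_mul_apply, c.const_apply p hp, c.const_apply p hp, c.const_apply p hp, map_mul]
    rw [h1, hD.2 i j _ (c.const_mem i a ha) _ (c.const_mem j b hb)]
    change (c.φ q).symm (D (c.const a) q * c.const b q +
      (-1 : ℝ) ^ (i * k).val • (c.const a q * D (c.const b) q)) = _
    simp only [map_add, map_mul, map_smul, c.const_apply q hq, AlgEquiv.symm_apply_apply]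
  · have : c.onConst q (D + D') = c.onConst q D + c.onConst q D' :=
      LinearMap.ext fun a => by
        change (c.φ q).symm (D (c.const a) q + D' (c.const a) q) = _
        rw [map_add]
        rfl
    rw [this]
    exact add_mem h h'

/-- In a chart the values of superderivations are operators of order one. -/
theorem exists_op_eq (hR : IsSupermanifold m n F R 𝒜) (hq : q ∈ c.U) (δ : derFibre m F 𝒜 q) :
    ∃ e : OperatorSymbol m n, e.1 ∈ sder (grassmannParity n) ∧ c.op q e = δ.1 := by
  obtain ⟨_, ⟨D, hD⟩, rfl⟩ := δ
  refine ⟨(c.onConst q D, fun j => (c.φ q).symm (D (ofFunction (c.x j)) q)),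
    onConst_mem hR hq hD, LinearMap.ext fun s => ?_⟩
  let b := Module.finBasis ℝ (Grassmann n)
  have hexp : ∀ a : Grassmann n, a = ∑ i, b.coord i a • b i := fun a => by
    conv_lhs => rw [← b.sum_repr a]
    rfl
  have hev : ∀ (t : Fin (Module.finrank ℝ (Grassmann n)) → Cₛ^∞⟮𝓡 m; F, R⟯) (p : M),
      (∑ i, t i) p = ∑ i, t i p := fun t p => by
    change ContMDiffSection.coeAddHom _ _ _ _ (∑ i, t i) p = _
    rw [map_sum, Finset.sum_apply]
    rfl
  -- Near `q` every superfunction is a combination of constants with function coefficients, so the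
  -- Leibniz rule expresses `D s` through constants and functions.
  have hs : D s q = D (∑ i, functionMul (c.coef (b.coord i) s) (c.const (b i))) q := by
    refine hR.superderivation_congr hD ?_
    filter_upwards [c.isOpen.mem_nhds hq] with p hp
    rw [hev]
    simp only [functionMul_apply, c.coef_apply p hp, c.const_apply p hp, ← map_smul]
    rw [← map_sum, ← hexp, AlgEquiv.apply_symm_apply]
  change _ = D s q
  rw [hs, map_sum, hev, op_apply]
  have h1 : (c.φ q).symm (s q) = ∑ i, c.coef (b.coord i) s q • b i := by
    conv_lhs => rw [hexp ((c.φ q).symm (s q))]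
    simp only [c.coef_apply q hq]
  have h2 : ∀ i, c.φ q (c.onConst q D (b i)) = D (c.const (b i)) q := fun i =>
    (c.φ q).apply_symm_apply _
  simp only [h1, map_add, map_sum, map_smul, h2, map_mul, AlgEquiv.apply_symm_apply, deriv_eq_sum,
    Finset.mul_sum, mul_smul_comm]
  rw [Finset.sum_comm, ← Finset.sum_add_distrib]
  refine Finset.sum_congr rfl fun i _ => ?_
  rw [hR.superderivation_functionMul hD, ContMDiffSection.coe_add, Pi.add_apply, section_mul_apply,
    functionMul_apply, superderivation_ofFunction hR hq hD, c.const_apply q hq, Finset.sum_mul,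
    add_comm]
  simp only [smul_mul_assoc]
  rfl

end Graded

end SuperChart

end SuperChartValues

/-! ### Smooth structures on the three families of fibres -/

section TheThreeBundles

variable {m n : ℕ} {M : Type*} [TopologicalSpace M] [ChartedSpace (EuclideanSpace ℝ (Fin m)) M]
  [IsManifold (𝓡 m) ∞ M]
  {F : Type*} [NormedAddCommGroup F] [NormedSpace ℝ F] {R : M → Type*}
  [∀ p, Ring (R p)] [∀ p, Algebra ℝ (R p)]
  [TopologicalSpace (TotalSpace F R)] [∀ p, TopologicalSpace (R p)] [FiberBundle F R]
  [VectorBundle ℝ F R]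
  {𝒜 : ∀ p, ZMod 2 → Submodule ℝ (R p)} [IsSmoothAlgebraBundle m F R]

omit [IsManifold (𝓡 m) ∞ M] [∀ p, Ring (R p)] [∀ p, Algebra ℝ (R p)] [VectorBundle ℝ F R]
  [IsSmoothAlgebraBundle m F R] in
theorem smoothSectionAt_congr {s t : ∀ p, R p} {q : M} (h : ∀ᶠ p in 𝓝 q, s p = t p)
    (hs : SmoothSectionAt m F s q) : SmoothSectionAt m F t q :=
  hs.congr_of_eventuallyEq (h.mono fun p hp => congrArg (TotalSpace.mk' F p) hp.symm)

omit [IsManifold (𝓡 m) ∞ M] [∀ p, TopologicalSpace (R p)] in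
theorem contractDiff_tmul (f : C^∞⟮𝓡 m, M; ℝ⟯) {q : M} (r : R q) (X : TangentSpace (𝓡 m) q) :
    contractDiff m f q (r ⊗ₜ[ℝ] X) = vectorDeriv m X f • r :=
  TensorProduct.rid_tmul _ _

namespace SuperChart

variable {c : SuperChart m n F R 𝒜} {q : M}

theorem smoothSectionAt_sderConj_iff (hq : q ∈ c.U) (g : M → sder (grassmannParity n)) :
    (∀ s : Cₛ^∞⟮𝓡 m; F, R⟯,
      SmoothSectionAt m F (fun p => (sderConj (c.φ p) (c.graded p) (g p)).1 (s p)) q) ↔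
    WeaklySmoothAt m g q := by
  refine ⟨fun h => ?_, fun h s => ?_⟩
  · refine WeaklySmoothAt.of_injective (Submodule.subtype_injective _)
      (WeaklySmoothAt.hom fun a => ?_)
    refine ((c.smooth_iff q hq _).1 (h (c.const a))).congr ?_
    filter_upwards [c.isOpen.mem_nhds hq] with p hp
    rw [sderConj_apply, c.const_apply p hp, AlgEquiv.symm_apply_apply, AlgEquiv.symm_apply_apply]
    rfl
  · rw [c.smooth_iff q hq]
    simp only [sderConj_apply, AlgEquiv.symm_apply_apply]
    exact WeaklySmoothAt.bilinear (Submodule.subtype _) h ((c.smooth_iff q hq _).1 (s.contMDiff q))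

variable (c q) in
/-- The elements of `R ⊗ TM` with given components. -/
def tensor : (Fin m → Grassmann n) →ₗ[ℝ] R q ⊗[ℝ] TangentSpace (𝓡 m) q :=
  ∑ j, (TensorProduct.mk ℝ (R q) (TangentSpace (𝓡 m) q)).flip (c.X j q) ∘ₗ
    (c.φ q).toLinearMap ∘ₗ LinearMap.proj j

theorem tensor_apply (r : Fin m → Grassmann n) :
    c.tensor q r = ∑ j, c.φ q (r j) ⊗ₜ[ℝ] c.X j q := by
  simp [tensor]

theorem contractDiff_tensor (f : C^∞⟮𝓡 m, M; ℝ⟯) (r : Fin m → Grassmann n) :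
    contractDiff m f q (c.tensor q r) = c.φ q (∑ j, vectorDeriv m (c.X j q) f • r j) := by
  simp only [tensor_apply, map_sum, contractDiff_tmul, map_smul]

theorem contractDiff_x_tensor (hq : q ∈ c.U) (i : Fin m) (r : Fin m → Grassmann n) :
    contractDiff m (c.x i) q (c.tensor q r) = c.φ q (r i) := by
  simp [contractDiff_tensor, vectorDeriv_x hq]

/-- Contraction with `dx_i` recovers the `i`-th component; surjectivity holds because the coordinate
fields form a basis of the tangent space. -/
theorem tensor_bijective (hq : q ∈ c.U) : Function.Bijective (c.tensor q) := by
  refine ⟨(injective_iff_map_eq_zero _).2 fun r hr => funext fun i => ?_, fun t => ?_⟩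
  · have := contractDiff_x_tensor hq i r
    rw [hr, map_zero] at this
    exact (map_eq_zero_iff _ (c.φ q).injective).1 this.symm
  · obtain ⟨b, hb⟩ := c.exists_basis hq
    induction t using TensorProduct.induction_on with
    | zero => exact ⟨0, map_zero _⟩
    | tmul r X =>
      refine ⟨fun j => b.repr X j • (c.φ q).symm r, ?_⟩
      rw [tensor_apply]
      simp only [map_smul, AlgEquiv.apply_symm_apply, TensorProduct.smul_tmul, ← hb]
      rw [← TensorProduct.tmul_sum, b.sum_repr]
    | add t t' h h' =>
      obtain ⟨r, rfl⟩ := h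
      obtain ⟨r', rfl⟩ := h'
      exact ⟨r + r', map_add _ _ _⟩

/-- The differentials of global functions separate elements of the fibre, since they include the
coordinate differentials. -/
theorem tensor_ext (hq : q ∈ c.U) {t t' : R q ⊗[ℝ] TangentSpace (𝓡 m) q}
    (h : ∀ f, contractDiff m f q t = contractDiff m f q t') : t = t' := by
  obtain ⟨r, rfl⟩ := (tensor_bijective hq).2 t
  obtain ⟨r', rfl⟩ := (tensor_bijective hq).2 t'
  congr 1
  ext i
  have := h (c.x i)
  rw [contractDiff_x_tensor hq, contractDiff_x_tensor hq] at this
  exact (c.φ q).injective this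

theorem smoothSectionAt_tensor_iff (hq : q ∈ c.U) (g : M → Fin m → Grassmann n) :
    (∀ f, SmoothSectionAt m F (fun p => contractDiff m f p (c.tensor p (g p))) q) ↔
    WeaklySmoothAt m g q := by
  refine ⟨fun h => WeaklySmoothAt.pi fun i => ?_, fun h f => ?_⟩
  · refine ((c.smooth_iff q hq _).1 (h (c.x i))).congr ?_
    filter_upwards [c.isOpen.mem_nhds hq] with p hp
    rw [contractDiff_x_tensor hp, AlgEquiv.symm_apply_apply]
  · rw [c.smooth_iff q hq]
    simp only [contractDiff_tensor, AlgEquiv.symm_apply_apply]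
    exact WeaklySmoothAt.sum fun j _ =>
      WeaklySmoothAt.smul (contMDiff_vectorDeriv j f q) (h.linearMap (LinearMap.proj j))

end SuperChart

variable [T2Space M] [FiniteDimensional ℝ F] [ContMDiffVectorBundle ∞ F R (𝓡 m)]
  [∀ p, GradedAlgebra (𝒜 p)]

theorem IsSupermanifold.exists_sderBundle (hR : IsSupermanifold m n F R 𝒜) :
    ∃ B : SmoothBundleStructure m (fun p => sderFibre 𝒜 p), ∀ A q,
      B.IsSmoothSectionAt A q ↔
        ∀ s : Cₛ^∞⟮𝓡 m; F, R⟯, SmoothSectionAt m F (fun p => (A p).1 (s p)) q := by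
  refine exists_smoothBundleStructure (E := sder (grassmannParity n)) _
    (fun A A' q h hA s => smoothSectionAt_congr (h.mono fun p hp => by rw [hp]) (hA s))
    fun p₀ => ?_
  obtain ⟨c, hc⟩ := hR.exists_superChart p₀
  exact ⟨c.U, c.isOpen, hc, fun q => (sderConj (c.φ q) (c.graded q)).toLinearMap, fun q hq =>
    ⟨LinearEquiv.bijective _, SuperChart.smoothSectionAt_sderConj_iff hq⟩⟩

theorem IsSupermanifold.exists_derBundle (hR : IsSupermanifold m n F R 𝒜) :
    ∃ B : SmoothBundleStructure m (fun p => derFibre m F 𝒜 p), ∀ δ q,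
      B.IsSmoothSectionAt δ q ↔
        ∀ s : Cₛ^∞⟮𝓡 m; F, R⟯, SmoothSectionAt m F (fun p => (δ p).1 s) q := by
  classical
  -- The model fibre: an endomorphism that is a superderivation, with unrestricted coefficients of
  -- the vector field.
  let E : Submodule ℝ (OperatorSymbol m n) :=
    (sder (grassmannParity n)).comap (LinearMap.fst ℝ _ _)
  refine exists_smoothBundleStructure (E := E) _
    (fun δ δ' q h hδ s => smoothSectionAt_congr (h.mono fun p hp => by rw [hp]) (hδ s))
    fun p₀ => ?_
  obtain ⟨c, hc⟩ := hR.exists_superChart p₀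
  -- Operators are known to be values of superderivations only over the chart, hence the default
  -- zero elsewhere.
  have hL : ∀ q, ∃ L : E →ₗ[ℝ] derFibre m F 𝒜 q, q ∈ c.U → ∀ e, (L e).1 = c.op q e.1 := by
    intro q
    by_cases hq : q ∈ c.U
    · exact ⟨LinearMap.codRestrict _ (c.op q ∘ₗ E.subtype) fun e =>
        SuperChart.op_mem_derFibre e.2 hq, fun _ _ => rfl⟩
    · exact ⟨0, fun h => absurd h hq⟩
  choose L hL using hL
  refine ⟨c.U, c.isOpen, hc, L, fun q hq => ⟨⟨fun e e' h => ?_, fun δ => ?_⟩, fun g => ?_⟩⟩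
  · refine Subtype.ext (SuperChart.op_injective hq ?_)
    rw [← hL q hq, ← hL q hq, h]
  · obtain ⟨e, he, heq⟩ := SuperChart.exists_op_eq hR hq δ
    exact ⟨⟨e, he⟩, Subtype.ext ((hL q hq _).trans heq)⟩
  · have hev : ∀ s, ∀ᶠ p in 𝓝 q, (L p (g p)).1 s = c.op p (g p).1 s := fun s => by
      filter_upwards [c.isOpen.mem_nhds hq] with p hp
      rw [hL p hp]
    refine ⟨fun h => WeaklySmoothAt.of_injective E.subtype_injective
      (SuperChart.weaklySmoothAt_of_op hq fun s => smoothSectionAt_congr (hev s) (h s)),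
      fun h s => smoothSectionAt_congr ((hev s).mono fun _ hp => hp.symm)
        (SuperChart.smoothSectionAt_op hq (h.linearMap E.subtype) s)⟩

theorem IsSupermanifold.exists_tensorBundle (hR : IsSupermanifold m n F R 𝒜) :
    ∃ B : SmoothBundleStructure m (fun p => R p ⊗[ℝ] TangentSpace (𝓡 m) p), ∀ t q,
      B.IsSmoothSectionAt t q ↔
        ∀ f : C^∞⟮𝓡 m, M; ℝ⟯, SmoothSectionAt m F (fun p => contractDiff m f p (t p)) q := by
  refine exists_smoothBundleStructure (E := Fin m → Grassmann n) _
    (fun t t' q h ht f => smoothSectionAt_congr (h.mono fun p hp => by rw [hp]) (ht f))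
    fun p₀ => ?_
  obtain ⟨c, hc⟩ := hR.exists_superChart p₀
  exact ⟨c.U, c.isOpen, hc, c.tensor, fun q hq =>
    ⟨SuperChart.tensor_bijective hq, SuperChart.smoothSectionAt_tensor_iff hq⟩⟩

omit [IsManifold (𝓡 m) ∞ M] [T2Space M] [FiniteDimensional ℝ F]
  [ContMDiffVectorBundle ∞ F R (𝓡 m)] in
/-- Smooth families of values of superderivations are superderivations. -/
theorem IsSupermanifold.exists_superVectorField (hR : IsSupermanifold m n F R 𝒜)
    (δ : ∀ p, derFibre m F 𝒜 p)
    (hδ : ∀ (s : Cₛ^∞⟮𝓡 m; F, R⟯) q, SmoothSectionAt m F (fun p => (δ p).1 s) q) :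
    ∃ D : SuperVectorField m F 𝒜, ∀ p, δ p = derValue m F 𝒜 p D := by
  have hex : ∀ p, ∃ D : ZMod 2 → Cₛ^∞⟮𝓡 m; F, R⟯ →ₗ[ℝ] Cₛ^∞⟮𝓡 m; F, R⟯,
      (∀ k, D k ∈ superderivationsOfParity (sectionParity m F 𝒜) k) ∧
      ∀ s, (δ p).1 s = D 0 s p + D 1 s p := fun p => by
    obtain ⟨⟨D, hD⟩, h⟩ := (δ p).2
    obtain ⟨D', hD', rfl⟩ := exists_parity_of_mem_sder hD
    exact ⟨D', hD', fun s => by rw [← h]; rfl⟩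
  choose D hD hδD using hex
  -- The chosen superderivation varies with `p` without any regularity. Its part of parity `k` is
  -- nevertheless forced: on a component of parity `i` it is the projection of `δ p` to parity `i +
  -- k`, hence smooth in `p`.
  have hproj : ∀ k s p, D p k s p =
      GradedRing.proj (𝒜 p) (0 + k) ((δ p).1 (hR.component 0 s)) +
      GradedRing.proj (𝒜 p) (1 + k) ((δ p).1 (hR.component 1 s)) := by
    intro k s p
    have h : ∀ i, GradedRing.proj (𝒜 p) (i + k) ((δ p).1 (hR.component i s))
        = D p k (hR.component i s) p := by
      intro i
      have hm : ∀ k', D p k' (hR.component i s) p ∈ 𝒜 p (i + k') := fun k' =>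
        (hD p k').1 i _ (hR.component_mem i s) p
      have hz : ∀ k : ZMod 2, k = 0 ∨ k = 1 := by decide
      rw [hδD, map_add]
      rcases hz k with rfl | rfl
      · rw [graded_proj_of_mem (hm 0), graded_proj_of_mem_ne (hm 1) (by simp), add_zero]
      · rw [graded_proj_of_mem (hm 1), graded_proj_of_mem_ne (hm 0) (by simp), zero_add]
    rw [h, h]
    conv_lhs => rw [← hR.component_add s, map_add]
    rfl
  have hsm : ∀ k s, ContMDiff (𝓡 m) ((𝓡 m).prod 𝓘(ℝ, F)) ∞
      (fun p => TotalSpace.mk' F p (D p k s p)) := fun k s q => by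
    simp only [hproj]
    exact (hR.contMDiffAt_component _ _ q (hδ _ q)).add_section
      (hR.contMDiffAt_component _ _ q (hδ _ q))
  let D' : ZMod 2 → Cₛ^∞⟮𝓡 m; F, R⟯ →ₗ[ℝ] Cₛ^∞⟮𝓡 m; F, R⟯ := fun k =>
    { toFun := fun s => ⟨_, hsm k s⟩
      map_add' := fun s t => ContMDiffSection.ext fun p => by
        change D p k (s + t) p = D p k s p + D p k t p
        rw [map_add]
        rfl
      map_smul' := fun r s => ContMDiffSection.ext fun p => by
        change D p k (r • s) p = r • D p k s p
        rw [map_smul]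
        rfl }
  have hD' : ∀ k, D' k ∈ superderivationsOfParity (sectionParity m F 𝒜) k := fun k =>
    ⟨fun i s hs p => (hD p k).1 i s hs p, fun i j s hs t ht => ContMDiffSection.ext fun p => by
      change D p k (s * t) p = D p k s p * t p + (-1 : ℝ) ^ (i * k).val • (s p * D p k t p)
      rw [(hD p k).2 i j s hs t ht]
      rfl⟩
  exact ⟨⟨D' 0 + D' 1, add_mem (superderivationsOfParity_le_sder _ 0 (hD' 0))
    (superderivationsOfParity_le_sder _ 1 (hD' 1))⟩,
    fun p => Subtype.ext (LinearMap.ext fun s => hδD p s)⟩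

/-! ### The exact sequence -/

/-- The value of superfunctions at a point. -/
def sectionEval (q : M) : Cₛ^∞⟮𝓡 m; F, R⟯ →ₗ[ℝ] R q where
  toFun s := s q
  map_add' _ _ := rfl
  map_smul' _ _ := rfl

-- Pointwise superderivations are the operators whose symbol has no vector field part; this is `ι`
-- in a chart.
omit [T2Space M] [FiniteDimensional ℝ F] [ContMDiffVectorBundle ∞ F R (𝓡 m)]
  [∀ p, GradedAlgebra (𝒜 p)] in
theorem SuperChart.op_sderConj {c : SuperChart m n F R 𝒜} {q : M} (A : sder (grassmannParity n)) :
    c.op q (A.1, 0) = (sderConj (c.φ q) (c.graded q) A).1 ∘ₗ sectionEval q :=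
  LinearMap.ext fun s => by
    rw [op_apply]
    simp only [Pi.zero_apply, zero_mul, Finset.sum_const_zero, add_zero]
    rfl

theorem IsSupermanifold.comp_sectionEval_mem (hR : IsSupermanifold m n F R 𝒜) (q : M)
    (A : sderFibre 𝒜 q) : A.1 ∘ₗ sectionEval q ∈ derFibre m F 𝒜 q := by
  obtain ⟨c, hq⟩ := hR.exists_superChart q
  obtain ⟨A, rfl⟩ := (sderConj (c.φ q) (c.graded q)).surjective A
  rw [← SuperChart.op_sderConj]
  exact SuperChart.op_mem_derFibre A.2 hq

/-- The inclusion of the pointwise superderivations. -/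
def IsSupermanifold.inclusion (hR : IsSupermanifold m n F R 𝒜) (q : M) :
    sderFibre 𝒜 q →ₗ[ℝ] derFibre m F 𝒜 q :=
  LinearMap.codRestrict _ ((sectionEval q).lcomp ℝ (R q) ∘ₗ Submodule.subtype _)
    (hR.comp_sectionEval_mem q)

theorem IsSupermanifold.inclusion_apply (hR : IsSupermanifold m n F R 𝒜) (q : M)
    (A : sderFibre 𝒜 q) (s : Cₛ^∞⟮𝓡 m; F, R⟯) : (hR.inclusion q A).1 s = A.1 (s q) := rfl

/-- The principal symbol of the values of superderivations. -/
theorem IsSupermanifold.exists_symbol (hR : IsSupermanifold m n F R 𝒜) (q : M) :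
    ∃ σ : derFibre m F 𝒜 q →ₗ[ℝ] R q ⊗[ℝ] TangentSpace (𝓡 m) q,
      ∀ δ f, contractDiff m f q (σ δ) = δ.1 (ofFunction f) := by
  obtain ⟨c, hq⟩ := hR.exists_superChart q
  refine ⟨∑ j, (TensorProduct.mk ℝ (R q) (TangentSpace (𝓡 m) q)).flip (c.X j q) ∘ₗ
    LinearMap.applyₗ (ofFunction (c.x j)) ∘ₗ Submodule.subtype _, fun δ f => ?_⟩
  obtain ⟨_, ⟨D, hD⟩, rfl⟩ := δ
  simp only [LinearMap.sum_apply, map_sum]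
  exact (Finset.sum_congr rfl fun j _ => contractDiff_tmul f _ _).trans
    (SuperChart.superderivation_ofFunction hR hq hD f).symm

/-- Superfunctions take every value at `q`, so `ι` is injective. A superderivation kills `1`, so
evaluation on functions sees only the coefficients `r`: these vanish exactly on the image of `ι`,
and the symbols `(0, r)` realize every tensor. -/
theorem IsSupermanifold.exact_inclusion_symbol (hR : IsSupermanifold m n F R 𝒜) (q : M)
    {σ : derFibre m F 𝒜 q →ₗ[ℝ] R q ⊗[ℝ] TangentSpace (𝓡 m) q}
    (hσ : ∀ δ f, contractDiff m f q (σ δ) = δ.1 (ofFunction f)) :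
    Function.Injective (hR.inclusion q) ∧ Function.Exact (hR.inclusion q) σ ∧
      Function.Surjective σ := by
  obtain ⟨c, hq⟩ := hR.exists_superChart q
  refine ⟨fun A A' h => Subtype.ext (LinearMap.ext fun a => ?_), fun δ => ⟨fun h => ?_, ?_⟩,
    fun t => ?_⟩
  · have h1 := hR.inclusion_apply q A (c.const ((c.φ q).symm a))
    have h2 := hR.inclusion_apply q A' (c.const ((c.φ q).symm a))
    rw [c.const_apply q hq, AlgEquiv.apply_symm_apply] at h1 h2
    rw [← h1, ← h2, h]
  · obtain ⟨e, he, hδ⟩ := SuperChart.exists_op_eq hR hq δ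
    have h1 : e.1 1 = 0 := sder_apply_one SetLike.GradedOne.one_mem he
    have h2 : e.2 = 0 := funext fun j => by
      have h3 := hσ δ (c.x j)
      rw [h, map_zero, ← hδ, SuperChart.op_x hq, h1, smul_zero, zero_add] at h3
      exact (map_eq_zero_iff _ (c.φ q).injective).1 h3.symm
    refine ⟨sderConj (c.φ q) (c.graded q) ⟨e.1, he⟩, Subtype.ext ?_⟩
    exact ((SuperChart.op_sderConj ⟨e.1, he⟩).symm.trans
      (congrArg (c.op q) (show (e.1, 0) = e from Prod.ext rfl h2.symm))).trans hδ
  · rintro ⟨A, rfl⟩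
    refine SuperChart.tensor_ext hq fun f => ?_
    rw [hσ, hR.inclusion_apply, ofFunction_apply, map_smul,
      sder_apply_one SetLike.GradedOne.one_mem A.2, smul_zero, map_zero]
  · obtain ⟨r, rfl⟩ := (SuperChart.tensor_bijective hq).2 t
    refine ⟨⟨c.op q (0, r), SuperChart.op_mem_derFibre (zero_mem _) hq⟩,
      SuperChart.tensor_ext hq fun f => ?_⟩
    rw [hσ, SuperChart.op_ofFunction hq, SuperChart.contractDiff_tensor]
    simp

end TheThreeBundles

end

theorem mainTheorem8 (m n : ℕ) {M : Type*} [TopologicalSpace M] [T2Space M]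
    [ChartedSpace (EuclideanSpace ℝ (Fin m)) M] [IsManifold (𝓡 m) ∞ M]
    (F : Type*) [NormedAddCommGroup F] [NormedSpace ℝ F] [FiniteDimensional ℝ F]
    (R : M → Type*) [∀ p, Ring (R p)] [∀ p, Algebra ℝ (R p)]
    [TopologicalSpace (TotalSpace F R)] [∀ p, TopologicalSpace (R p)] [FiberBundle F R]
    [VectorBundle ℝ F R] [ContMDiffVectorBundle ∞ F R (𝓡 m)]
    (𝒜 : ∀ p, ZMod 2 → Submodule ℝ (R p)) [∀ p, GradedAlgebra (𝒜 p)]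
    [IsSmoothAlgebraBundle m F R] (hR : IsSupermanifold m n F R 𝒜) :
    -- superderivations are differential operators of order at most one
    (∀ D ∈ SuperVectorField m F 𝒜, IsDiffOp 1 D) ∧
    -- the three smooth vector bundles
    ∃ (Bs : SmoothBundleStructure m (fun p => sderFibre 𝒜 p))
      (BD : SmoothBundleStructure m (fun p => derFibre m F 𝒜 p))
      (BT : SmoothBundleStructure m (fun p => R p ⊗[ℝ] TangentSpace (𝓡 m) p)),
      IsPointwiseDerivationBundle F 𝒜 Bs ∧ IsDerivationBundle F 𝒜 BD ∧
      IsTensorTangentBundle F BT ∧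
      -- the bundle maps
      ∃ (ι : ∀ p, sderFibre 𝒜 p →ₗ[ℝ] derFibre m F 𝒜 p)
        (σ : ∀ p, derFibre m F 𝒜 p →ₗ[ℝ] R p ⊗[ℝ] TangentSpace (𝓡 m) p),
        Bs.IsSmoothMap BD ι ∧ BD.IsSmoothMap BT σ ∧
        -- `ι` is the inclusion: a pointwise derivation acts on sections fibrewise
        (∀ p (A : sderFibre 𝒜 p) (s : Cₛ^∞⟮𝓡 m; F, R⟯), (ι p A).1 s = A.1 (s p)) ∧
        -- `σ` is the principal symbol, `r ⊗ X` being the map `f ↦ (η ↦ r X(f) η)`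
        (∀ p (D : SuperVectorField m F 𝒜) (f : C^∞⟮𝓡 m, M; ℝ⟯) (η : Cₛ^∞⟮𝓡 m; F, R⟯),
          principalSymbolOne D.1 f η p
            = contractDiff m f p (σ p (derValue m F 𝒜 p D)) * η p) ∧
        -- exactness
        (∀ p, Function.Injective (ι p) ∧ Function.Exact (ι p) (σ p) ∧
          Function.Surjective (σ p)) := by
  obtain ⟨Bs, hBs⟩ := hR.exists_sderBundle
  obtain ⟨BD, hBD⟩ := hR.exists_derBundle
  obtain ⟨BT, hBT⟩ := hR.exists_tensorBundle
  choose σ hσ using hR.exists_symbol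
  refine ⟨fun D hD => hR.isDiffOp_one hD, Bs, BD, BT, fun A => ?_, fun δ => ?_, fun r X => ?_,
    hR.inclusion, σ, ?_, ?_, hR.inclusion_apply, fun p D f η => ?_,
    fun p => hR.exact_inclusion_symbol p (hσ p)⟩
  · rw [Bs.isSmoothSection_iff]
    simp only [hBs]
    exact forall_comm
  · rw [BD.isSmoothSection_iff]
    simp only [hBD]
    refine ⟨fun h => hR.exists_superVectorField δ fun s q => h q s, ?_⟩
    rintro ⟨D, hD⟩ q s
    simp only [hD]
    exact (D.1 s).contMDiff q
  · rw [BT.isSmoothSection_iff]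
    simp only [hBT, contractDiff_tmul]
    exact fun q f => ContMDiffAt.smul_section
      (contMDiffAt_mvfderiv_apply (f.contMDiff q) (X.contMDiff q)) (r.contMDiff q)
  -- Both sides are tested on the same superfunctions, with the same values.
  · refine Bs.isSmoothMap_of_isSmoothSectionAt BD _ fun A q hA => ?_
    rw [hBs] at hA
    rw [hBD]
    exact hA
  -- Contracting the symbol with `df` evaluates `δ` on the superfunction `f`, which is one of the
  -- tests for `δ`.
  · refine BD.isSmoothMap_of_isSmoothSectionAt BT _ fun δ q hδ => ?_
    rw [hBD] at hδ
    rw [hBT]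
    simp only [hσ]
    exact fun f => hδ _
  · rw [hσ]
    exact congrArg (fun s : Cₛ^∞⟮𝓡 m; F, R⟯ => s p) (hR.opCommutator_apply D.2 f η)
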